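/- Let $K$ be an algebraically closed field, $\Lambda$ a finite dimensional associative unital $K$-algebra, and $\widetilde\Lambda=\Lambda\otimes_K K[\epsilon]/(\epsilon^2)$. Modules are finitely generated right modules. For a finite dimensional algebra $A$ and a module $M$ let $|M|$ be the number of pairwise nonisomorphic indecomposable direct summands of $M$, and let $\tau=D\,\mathrm{Tr}$ be the Auslander–Reiten translation. The module $M$ is called $\tau$-rigid if $\mathrm{Hom}_A(M,\tau M)=0$, and support $\tau$-tilting if it is $\tau$-rigid and there is a projective module $P$ with $\mathrm{Hom}_A(P,M)=0$ and $|M\oplus P|=|A|$ (the rank of $A$). It is called basic if no indecomposable module occurs twice in a direct sum decomposition of it. The induction functor $-\otimes_\Lambda\widetilde\Lambda$ (along $\Lambda\to\widetilde\Lambda$, $\lambda\mapsto\lambda\otimes 1$) induces a bijection between the isomorphism classes of support $\tau$-tilting $\Lambda$-modules and the isomorphism classes of support $\tau$-tilting $\widetilde\Lambda$-modules. It restricts to a bijection between the isomorphism classes of basic support $\tau$-tilting modules on the two sides. Moreover, if $P_1,\dots,P_n$ is a complete list, without repetition, of the indecomposable projective $\Lambda$-modules up to isomorphism, then $P_1\otimes_\Lambda\widetilde\Lambda,\dots,P_n\otimes_\Lambda\widetilde\Lambda$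 is such a list for $\widetilde\Lambda$, and with respect to these lists $M$ and $M\otimes_\Lambda\widetilde\Lambda$ have the same (well-defined) $g$-vector in $\mathbb Z^n$ for every finitely generated $\Lambda$-module $M$; in particular, corresponding support $\tau$-tilting modules have the same $g$-vectors. Here the $g$-vector of a module $M$ is $[P^0]-[P^1]$, where $P^1\to P^0\to M\to 0$ is a minimal projective presentation and $[Q]=(m_1,\dots,m_n)$ if $Q$ is isomorphic to the direct sum of $m_i$ copies of the $i$-th module of the list, $i=1,\dots,n$. -/

import Mathlib

open scoped TensorProduct MulOpposite

universe u

noncomputable section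

namespace TauTilting

/-! ### Isomorphism classes, indecomposable summands

Throughout, `A` is a ring and modules are left `A`-modules. Right modules over `Λ` are the case
`A = Λᵐᵒᵖ`. -/

section Summands

variable (A : Type u) [Ring A]

/-- Isomorphism classes of `A`-modules. -/
abbrev IsoClass : Type (u + 1) :=
  Quotient (CategoryTheory.isIsomorphicSetoid (ModuleCat.{u} A))

/-- A module is indecomposable if it is nonzero and in every decomposition into an (internal)
direct sum of two submodules one of the two is zero. -/
def IsIndecomposable (X : Type u) [AddCommGroup X] [Module A X] : Prop :=
  Nontrivial X ∧ ∀ U V : Submodule A X, IsCompl U V → U = ⊥ ∨ V = ⊥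

/-- `X` is isomorphic to a direct summand of `M`. -/
def IsSummand (X M : Type u) [AddCommGroup X] [Module A X] [AddCommGroup M] [Module A M] : Prop :=
  ∃ (i : X →ₗ[A] M) (r : M →ₗ[A] X), r ∘ₗ i = LinearMap.id

/-- `|M|`: the number of pairwise nonisomorphic indecomposable direct summands of `M`. -/
def numIndec (M : Type u) [AddCommGroup M] [Module A M] : ℕ∞ :=
  Set.encard {c : IsoClass A | ∃ X : ModuleCat.{u} A,
    IsIndecomposable A X ∧ IsSummand A X M ∧ (⟦X⟧ : IsoClass A) = c}

/-- A module is basic if no indecomposable module occurs twice as a direct summand. -/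
def IsBasic (M : Type u) [AddCommGroup M] [Module A M] : Prop :=
  ∀ X : ModuleCat.{u} A, IsIndecomposable A X → ¬ IsSummand A (X × X) M

end Summands

/-! ### Minimal projective presentations -/

section Presentation

variable {A : Type u} [Ring A]

/-- A submodule `U` is superfluous if `U + V` is proper for every proper submodule `V`. -/
def IsSuperfluous {M : Type u} [AddCommGroup M] [Module A M] (U : Submodule A M) : Prop :=
  ∀ V : Submodule A M, U ⊔ V = ⊤ → V = ⊤

/-- `P₁ --d--> P₀ --π--> M --> 0` is a minimal projective presentation with finitely generated
terms: it is exact, `π` is a projective cover of `M`, and `d` is a projective cover of its image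
`ker π`. -/
structure IsMinProjPres {P₁ P₀ M : Type u} [AddCommGroup P₁] [Module A P₁]
    [AddCommGroup P₀] [Module A P₀] [AddCommGroup M] [Module A M]
    (d : P₁ →ₗ[A] P₀) (π : P₀ →ₗ[A] M) : Prop where
  finite₁ : Module.Finite A P₁
  finite₀ : Module.Finite A P₀
  projective₁ : Module.Projective A P₁
  projective₀ : Module.Projective A P₀
  surjective : Function.Surjective π
  exact : Function.Exact d π
  minimal₀ : IsSuperfluous (LinearMap.ker π)
  minimal₁ : IsSuperfluous (LinearMap.ker d)

end Presentation

/-! ### The Auslander-Reiten translate `τ = D Tr` -/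

section Translate

/-- The `K`-dual `D N = Hom_K(N, K)` of a right `A`-module `N`. It is a left `A`-module through
`(a φ)(n) = φ(n a)`. -/
def KDual (K A N : Type u) [Field K] [Ring A] [Algebra K A] [AddCommGroup N] [Module K N]
    [Module Aᵐᵒᵖ N] [IsScalarTower K Aᵐᵒᵖ N] : Type u :=
  N →ₗ[K] K

variable (K : Type u) [Field K] {A : Type u} [Ring A] [Algebra K A]

instance (N : Type u) [AddCommGroup N] [Module K N] [Module Aᵐᵒᵖ N] [IsScalarTower K Aᵐᵒᵖ N] :
    AddCommGroup (KDual K A N) :=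
  inferInstanceAs (AddCommGroup (N →ₗ[K] K))

instance (N : Type u) [AddCommGroup N] [Module K N] [Module Aᵐᵒᵖ N] [IsScalarTower K Aᵐᵒᵖ N] :
    Module A (KDual K A N) where
  smul a φ := LinearMap.comp (show N →ₗ[K] K from φ)
    (Module.toModuleEnd K (S := Aᵐᵒᵖ) N (MulOpposite.op a))
  one_smul φ := by
    refine LinearMap.ext fun n => ?_
    exact congrArg (show N →ₗ[K] K from φ) (one_smul Aᵐᵒᵖ n)
  mul_smul a b φ := by
    refine LinearMap.ext fun n => ?_
    exact congrArg (show N →ₗ[K] K from φ) (mul_smul (MulOpposite.op b) (MulOpposite.op a) n)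
  smul_zero a := LinearMap.ext fun n => rfl
  smul_add a φ ψ := LinearMap.ext fun n => rfl
  add_smul a b φ := by
    refine LinearMap.ext fun n => ?_
    exact (congrArg (show N →ₗ[K] K from φ)
      (add_smul (MulOpposite.op a) (MulOpposite.op b) n)).trans
      (map_add (show N →ₗ[K] K from φ) _ _)
  zero_smul φ := by
    refine LinearMap.ext fun n => ?_
    exact (congrArg (show N →ₗ[K] K from φ) (zero_smul Aᵐᵒᵖ n)).trans
      (map_zero (show N →ₗ[K] K from φ))

/-- The map `Hom_A(d, A) : Hom_A(P₀, A) → Hom_A(P₁, A)` of right `A`-modules. -/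
def homDual {P₁ P₀ : Type u} [AddCommGroup P₁] [Module A P₁] [AddCommGroup P₀] [Module A P₀]
    (d : P₁ →ₗ[A] P₀) : (P₀ →ₗ[A] A) →ₗ[Aᵐᵒᵖ] (P₁ →ₗ[A] A) where
  toFun f := f ∘ₗ d
  map_add' _ _ := rfl
  map_smul' _ _ := rfl

/-- The transpose `Tr M = coker Hom_A(d, A)`, a right `A`-module, where `d` is the first map of a
minimal projective presentation of `M`. -/
abbrev Transpose {P₁ P₀ : Type u} [AddCommGroup P₁] [Module A P₁] [AddCommGroup P₀] [Module A P₀]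
    (d : P₁ →ₗ[A] P₀) : Type u :=
  (P₁ →ₗ[A] A) ⧸ LinearMap.range (homDual d)

/-- The Auslander-Reiten translate `τ M = D Tr M`, where `d` is the first map of a minimal
projective presentation of `M`. -/
abbrev ARTranslate {P₁ P₀ : Type u} [AddCommGroup P₁] [Module A P₁]
    [AddCommGroup P₀] [Module A P₀] (d : P₁ →ₗ[A] P₀) : Type u :=
  KDual K A (Transpose d)

end Translate

/-! ### Support `τ`-tilting modules and `g`-vectors -/

section SupportTauTilting

variable (K : Type u) [Field K] (A : Type u) [Ring A] [Algebra K A]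

/-- A finitely generated module `M` is `τ`-rigid if `Hom_A(M, τ M) = 0`. (Minimal projective
presentations are unique up to isomorphism, so the choice of one does not matter.) -/
def IsTauRigid (M : Type u) [AddCommGroup M] [Module A M] : Prop :=
  Module.Finite A M ∧
    ∃ (P₁ P₀ : ModuleCat.{u} A) (d : P₁ →ₗ[A] P₀) (π : P₀ →ₗ[A] M),
      IsMinProjPres d π ∧ ∀ f : M →ₗ[A] ARTranslate K d, f = 0

/-- `M ⊕ P[1]` is a support `τ`-tilting pair. The rank of `A` is the number `|A|` of nonisomorphic
indecomposable direct summands of the regular module. -/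
def IsSupportTauTiltingPair (M P : Type u) [AddCommGroup M] [Module A M]
    [AddCommGroup P] [Module A P] : Prop :=
  IsTauRigid K A M ∧ Module.Finite A P ∧ Module.Projective A P ∧
    (∀ f : P →ₗ[A] M, f = 0) ∧ numIndec A (M × P) = numIndec A A

/-- `M` is a support `τ`-tilting module. -/
def IsSupportTauTilting (M : Type u) [AddCommGroup M] [Module A M] : Prop :=
  ∃ P : ModuleCat.{u} A, IsSupportTauTiltingPair K A M P

variable {A}

/-- `P 0, …, P (n-1)` is a complete list of representatives of the isomorphism classes of
indecomposable finitely generated projective modules, without repetition. -/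
structure IsProjIndecList {n : ℕ} (P : Fin n → ModuleCat.{u} A) : Prop where
  finite : ∀ i, Module.Finite A (P i)
  projective : ∀ i, Module.Projective A (P i)
  indecomposable : ∀ i, IsIndecomposable A (P i)
  injective : ∀ i j, Nonempty (P i ≃ₗ[A] P j) → i = j
  complete : ∀ Q : ModuleCat.{u} A, Module.Finite A Q → Module.Projective A Q →
    IsIndecomposable A Q → ∃ i, Nonempty (Q ≃ₗ[A] P i)

/-- `g = [P⁰] - [P¹]` for a minimal projective presentation `P¹ → P⁰ → M → 0`, where
`[Q] = (m₀, …, mₙ₋₁)` if `Q ≅ ⨁ᵢ (P i)^{mᵢ}`. -/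
def IsGVector {n : ℕ} (P : Fin n → ModuleCat.{u} A) (M : Type u) [AddCommGroup M] [Module A M]
    (g : Fin n → ℤ) : Prop :=
  ∃ (P₁ P₀ : ModuleCat.{u} A) (d : P₁ →ₗ[A] P₀) (π : P₀ →ₗ[A] M), IsMinProjPres d π ∧
    ∃ a b : Fin n → ℕ,
      Nonempty (P₀ ≃ₗ[A] ((i : Fin n) → Fin (a i) → P i)) ∧
      Nonempty (P₁ ≃ₗ[A] ((i : Fin n) → Fin (b i) → P i)) ∧
      ∀ i, g i = (a i : ℤ) - (b i : ℤ)

end SupportTauTilting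

/-! ### The induction functor `- ⊗_R B` along a ring homomorphism `R → B` -/

section Induction

variable {R B : Type u} [Ring R] [Ring B] (φ : R →+* B)

/-- The relations defining `M ⊗_R B` for a right `R`-module `M`, with the factor `B` written on the
left: `(r b) ⊗ m = b ⊗ (m r)`. -/
def balancedRel (M : Type u) [AddCommGroup M] [Module Rᵐᵒᵖ M] : Submodule Bᵐᵒᵖ (B ⊗[ℤ] M) :=
  Submodule.span Bᵐᵒᵖ {z | ∃ (r : R) (b : B) (m : M),
    z = (φ r * b) ⊗ₜ[ℤ] m - b ⊗ₜ[ℤ] (MulOpposite.op r • m)}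

/-- `M ⊗_R B` as a right `B`-module. -/
abbrev Ind (M : Type u) [AddCommGroup M] [Module Rᵐᵒᵖ M] : Type u :=
  (B ⊗[ℤ] M) ⧸ balancedRel φ M

/-- `id_B ⊗ f` before passing to the quotient. -/
def preIndMap {M N : Type u} [AddCommGroup M] [Module Rᵐᵒᵖ M] [AddCommGroup N] [Module Rᵐᵒᵖ N]
    (f : M →ₗ[Rᵐᵒᵖ] N) : (B ⊗[ℤ] M) →ₗ[Bᵐᵒᵖ] (B ⊗[ℤ] N) :=
  TensorProduct.AlgebraTensorModule.map (LinearMap.id : B →ₗ[Bᵐᵒᵖ] B) f.toAddMonoidHom.toIntLinearMap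

theorem preIndMap_tmul {M N : Type u} [AddCommGroup M] [Module Rᵐᵒᵖ M]
    [AddCommGroup N] [Module Rᵐᵒᵖ N] (f : M →ₗ[Rᵐᵒᵖ] N) (b : B) (m : M) :
    preIndMap f (b ⊗ₜ[ℤ] m) = b ⊗ₜ[ℤ] f m := rfl

theorem balancedRel_le_comap {M N : Type u} [AddCommGroup M] [Module Rᵐᵒᵖ M]
    [AddCommGroup N] [Module Rᵐᵒᵖ N] (f : M →ₗ[Rᵐᵒᵖ] N) :
    balancedRel φ M ≤ (balancedRel φ N).comap (preIndMap f) := by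
  refine Submodule.span_le.2 ?_
  rintro _ ⟨r, b, m, rfl⟩
  refine Submodule.subset_span ⟨r, b, f m, ?_⟩
  rw [map_sub, preIndMap_tmul, preIndMap_tmul, map_smul]

/-- `f ⊗_R B : M ⊗_R B → N ⊗_R B`. -/
def indMap {M N : Type u} [AddCommGroup M] [Module Rᵐᵒᵖ M] [AddCommGroup N] [Module Rᵐᵒᵖ N]
    (f : M →ₗ[Rᵐᵒᵖ] N) : Ind φ M →ₗ[Bᵐᵒᵖ] Ind φ N :=
  Submodule.mapQ _ _ (preIndMap f) (balancedRel_le_comap φ f)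

/-- The induction functor `- ⊗_R B : Mod-R ⥤ Mod-B`. -/
def induction : CategoryTheory.Functor (ModuleCat.{u} Rᵐᵒᵖ) (ModuleCat.{u} Bᵐᵒᵖ) where
  obj M := ModuleCat.of Bᵐᵒᵖ (Ind φ M)
  map f := ModuleCat.ofHom (indMap φ f.hom)
  map_id M := by
    refine ModuleCat.hom_ext (LinearMap.ext fun x => ?_)
    obtain ⟨y, rfl⟩ := Submodule.Quotient.mk_surjective _ x
    refine congrArg (Submodule.Quotient.mk (p := balancedRel φ M)) ?_
    induction y with
    | zero => exact map_zero _
    | tmul b m => rfl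
    | add y z hy hz => rw [map_add, hy, hz]
  map_comp {M N L} f g := by
    refine ModuleCat.hom_ext (LinearMap.ext fun x => ?_)
    obtain ⟨y, rfl⟩ := Submodule.Quotient.mk_surjective _ x
    refine congrArg (Submodule.Quotient.mk (p := balancedRel φ L))
      (a₂ := preIndMap g.hom (preIndMap f.hom y)) ?_
    induction y with
    | zero => simp
    | tmul b m => rfl
    | add y z hy hz => rw [map_add, hy, hz, map_add, map_add]

end Induction

/-- The map on isomorphism classes of modules induced by a functor. -/
def mapIsoClass {A B : Type u} [Ring A] [Ring B]
    (F : CategoryTheory.Functor (ModuleCat.{u} A) (ModuleCat.{u} B)) : IsoClass A → IsoClass B :=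
  Quotient.map F.obj fun _ _ ⟨e⟩ => ⟨F.mapIso e⟩

/-- Isomorphism classes of support `τ`-tilting modules. -/
def supportTauTiltingClasses (K : Type u) [Field K] (A : Type u) [Ring A] [Algebra K A] :
    Set (IsoClass A) :=
  {c | ∃ M : ModuleCat.{u} A, IsSupportTauTilting K A M ∧ (⟦M⟧ : IsoClass A) = c}

/-- Isomorphism classes of basic support `τ`-tilting modules. -/
def basicSupportTauTiltingClasses (K : Type u) [Field K] (A : Type u) [Ring A] [Algebra K A] :
    Set (IsoClass A) :=
  {c | ∃ M : ModuleCat.{u} A, IsSupportTauTilting K A M ∧ IsBasic A M ∧ (⟦M⟧ : IsoClass A) = c}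

/-- `Λ̃ = Λ ⊗_K K[ε]/(ε²)`. -/
abbrev Tilde (K Λ : Type u) [Field K] [Ring Λ] [Algebra K Λ] : Type u :=
  Λ ⊗[K] DualNumber K

/-- The induction functor `- ⊗_Λ Λ̃` along `λ ↦ λ ⊗ 1`. -/
abbrev tildeInduction (K Λ : Type u) [Field K] [Ring Λ] [Algebra K Λ] :
    CategoryTheory.Functor (ModuleCat.{u} Λᵐᵒᵖ) (ModuleCat.{u} (Tilde K Λ)ᵐᵒᵖ) :=
  induction (Algebra.TensorProduct.includeLeftRingHom : Λ →+* Tilde K Λ)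

end TauTilting

end

namespace TauTilting

/-! ### Projective covers and their uniqueness -/

section ProjectiveCover

variable {A : Type u} [Ring A]
  {M P Q : Type u} [AddCommGroup M] [Module A M] [AddCommGroup P] [Module A P]
  [AddCommGroup Q] [Module A Q]

/-! Write `A` for `Λᵐᵒᵖ` and `B = A[ε]` for the opposite of `Λ̃`. An induced `B`-module is `M ⊕ εM`,
and a `B`-linear map between induced modules is uniquely `f₀ + ε f₁` with `A`-linear `f₀`, `f₁`.
Passing to `f₀` respects composition, so an isomorphism or a splitting of induced modules already
exists over `A`. An idempotent `e₀ + ε e₁` has `e₀` idempotent, and its image is induced from that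
of `e₀`. Hence summands of induced modules are induced, every finitely generated projective
`B`-module is induced, and indecomposability, `|M|` and basicness agree on both sides.

The condition `Hom(M, τM) = 0` is a property of the minimal presentation `d : P₁ → P₀` alone: every
map `P₁ → P₀` is `a d + d b` (`hom_arTranslate_eq_zero_iff_isRigidMap`). Rigidity of `d` passes to
the induced map componentwise. Conversely, a presentation of a `τ`-rigid `B`-module is some `D = d₀
+ ε d₁`, and rigidity of `D` forces that of `d₀`. Then `d₁ = a d₀ + d₀ b`, so `D = (1 + εa) d₀ (1 +
εb)`: a first order deformation of a rigid map is trivial (`exists_trivialization`). Therefore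
`coker D` is induced from `coker d₀`, and `d₀` is again a minimal presentation. This is surjectivity
on support `τ`-tilting classes (`exists_of_isTauRigid`); injectivity is reduction modulo `ε`.

Since `ε` is nilpotent, induction preserves superfluous kernels. It therefore carries minimal
presentations to minimal presentations with the same multiplicities, which gives the `g`-vectors. -/

theorem IsSuperfluous.surjective_of_comp {π : P →ₗ[A] M} (hπ : IsSuperfluous (LinearMap.ker π))
    (f : Q →ₗ[A] P) (hf : Function.Surjective (π ∘ₗ f)) : Function.Surjective f := by
  rw [← LinearMap.range_eq_top]
  refine hπ _ (eq_top_iff.2 fun x _ => ?_)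
  obtain ⟨y, hy⟩ := hf (π x)
  refine Submodule.mem_sup.2 ⟨x - f y, ?_, f y, ⟨y, rfl⟩, sub_add_cancel _ _⟩
  rw [LinearMap.mem_ker, map_sub, sub_eq_zero]
  exact hy.symm

/-- Two projective covers of the same module are isomorphic over that module. -/
theorem exists_equiv_of_projectiveCovers [Module.Projective A P] [Module.Projective A Q]
    {π : P →ₗ[A] M} {ρ : Q →ₗ[A] M} (hπ : Function.Surjective π) (hρ : Function.Surjective ρ)
    (hπs : IsSuperfluous (LinearMap.ker π)) (hρs : IsSuperfluous (LinearMap.ker ρ)) :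
    ∃ e : P ≃ₗ[A] Q, ρ ∘ₗ e.toLinearMap = π := by
  obtain ⟨f, hf⟩ := Module.projective_lifting_property ρ π hρ
  have hfs : Function.Surjective f := hρs.surjective_of_comp f (by rw [hf]; exact hπ)
  -- The section `s` of `f` satisfies `π s = ρ f s = ρ`, so it is surjective as well; this makes `f`
  -- injective.
  obtain ⟨s, hs⟩ := Module.projective_lifting_property f LinearMap.id hfs
  have hss : Function.Surjective s := by
    refine hπs.surjective_of_comp s ?_
    rw [← hf, LinearMap.comp_assoc, hs]
    exact hρ
  have hfi : Function.Injective f := by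
    intro x y hxy
    obtain ⟨x, rfl⟩ := hss x
    obtain ⟨y, rfl⟩ := hss y
    have h := fun z => LinearMap.congr_fun hs z
    simp only [LinearMap.comp_apply, LinearMap.id_apply] at h
    rw [h, h] at hxy
    rw [hxy]
  exact ⟨LinearEquiv.ofBijective f ⟨hfi, hfs⟩, hf⟩

/-- Uniqueness of projective covers is used twice: for `M`, and then for `ker π'`, which is covered
both by `d'` and by `d` transported along the isomorphism `e` of the first step. -/
theorem IsMinProjPres.nonempty_equiv {P₁ P₀ Q₁ Q₀ : Type u} [AddCommGroup P₁] [Module A P₁]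
    [AddCommGroup P₀] [Module A P₀] [AddCommGroup Q₁] [Module A Q₁] [AddCommGroup Q₀] [Module A Q₀]
    {d : P₁ →ₗ[A] P₀} {π : P₀ →ₗ[A] M} {d' : Q₁ →ₗ[A] Q₀} {π' : Q₀ →ₗ[A] M}
    (h : IsMinProjPres d π) (h' : IsMinProjPres d' π') :
    Nonempty (P₀ ≃ₗ[A] Q₀) ∧ Nonempty (P₁ ≃ₗ[A] Q₁) := by
  have := h.projective₀
  have := h'.projective₀
  have := h.projective₁
  have := h'.projective₁
  obtain ⟨e, he⟩ := exists_equiv_of_projectiveCovers h.surjective h'.surjective h.minimal₀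
    h'.minimal₀
  refine ⟨⟨e⟩, ?_⟩
  have hd : ∀ x, (e.toLinearMap ∘ₗ d) x ∈ LinearMap.ker π' := fun x => by
    have := LinearMap.congr_fun he (d x)
    simp only [LinearMap.comp_apply] at this
    rw [LinearMap.mem_ker, LinearMap.comp_apply, this]
    exact (h.exact _).2 ⟨x, rfl⟩
  have hd' : ∀ x, d' x ∈ LinearMap.ker π' := fun x => (h'.exact _).2 ⟨x, rfl⟩
  obtain ⟨e₁, -⟩ := exists_equiv_of_projectiveCovers
    (π := (e.toLinearMap ∘ₗ d).codRestrict _ hd) (ρ := d'.codRestrict _ hd')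
    (by
      rintro ⟨y, hy⟩
      have := LinearMap.congr_fun he (e.symm y)
      simp only [LinearMap.comp_apply, LinearEquiv.coe_coe, LinearEquiv.apply_symm_apply] at this
      obtain ⟨x, hx⟩ := (h.exact (e.symm y)).1 (by rw [← this]; exact hy)
      refine ⟨x, Subtype.ext ?_⟩
      simp [hx])
    (by
      rintro ⟨y, hy⟩
      obtain ⟨x, hx⟩ := (h'.exact y).1 hy
      exact ⟨x, Subtype.ext hx⟩)
    (by
      rw [LinearMap.ker_codRestrict, LinearEquiv.ker_comp]
      exact h.minimal₁)
    (by
      rw [LinearMap.ker_codRestrict]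
      exact h'.minimal₁)
  exact ⟨e₁⟩

end ProjectiveCover

/-! ### Existence of minimal projective presentations -/

section Existence

variable {A : Type u} [Ring A]

/-- Fitting's lemma. If `V` is proper with `ker π + V = P`, lifting `π` through `V` gives an
endomorphism `s` with `π s = π` and image in `V`. For large `n`, the range of `s ^ n` is a direct
summand on which `π` is still surjective. -/
theorem exists_lt_summand_of_not_isSuperfluous {M P : Type u} [AddCommGroup M] [Module A M]
    [AddCommGroup P] [Module A P] [IsArtinian A P] [IsNoetherian A P] [Module.Projective A P]
    {π : P →ₗ[A] M} (hπ : Function.Surjective π) (hs : ¬ IsSuperfluous (LinearMap.ker π)) :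
    ∃ W : Submodule A P, W ≠ ⊤ ∧ Module.Projective A W ∧
      Function.Surjective (π ∘ₗ W.subtype) := by
  simp only [IsSuperfluous, not_forall] at hs
  obtain ⟨V, hV, hVt⟩ := hs
  have hVs : Function.Surjective (π ∘ₗ V.subtype) := by
    intro m
    obtain ⟨x, rfl⟩ := hπ m
    obtain ⟨k, hk, v, hv, rfl⟩ := Submodule.mem_sup.1 (hV ▸ Submodule.mem_top : x ∈ _ ⊔ V)
    refine ⟨⟨v, hv⟩, ?_⟩
    rw [map_add, LinearMap.mem_ker.1 hk, zero_add]
    rfl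
  obtain ⟨t, ht⟩ := Module.projective_lifting_property _ π hVs
  set s : Module.End A P := V.subtype ∘ₗ t with hsdef
  have hπs : π ∘ₗ s = π := by rw [hsdef, ← LinearMap.comp_assoc, ht]
  have hπn : ∀ n : ℕ, π ∘ₗ (s ^ n) = π := by
    intro n
    induction n with
    | zero => rfl
    | succ n ih => rw [pow_succ, Module.End.mul_eq_comp, ← LinearMap.comp_assoc, ih, hπs]
  -- `n ≥ 1` is needed to keep the range of `s ^ n` inside the proper submodule `V`.
  obtain ⟨n, hn, hc⟩ := ((Filter.eventually_ge_atTop 1).and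
    (LinearMap.eventually_isCompl_ker_pow_range_pow s)).exists
  refine ⟨LinearMap.range (s ^ n), ?_, ?_, ?_⟩
  · intro htop
    refine hVt (top_le_iff.1 (htop ▸ ?_))
    rintro _ ⟨x, rfl⟩
    obtain ⟨k, rfl⟩ := Nat.exists_eq_add_of_le hn
    rw [pow_add, pow_one, Module.End.mul_apply]
    exact (t _).2
  · exact Module.Projective.of_split (Submodule.subtype _) (Submodule.projectionOnto _ _ hc.symm)
      (Submodule.projectionOnto_comp_subtype hc.symm)
  · intro m
    obtain ⟨x, rfl⟩ := hπ m
    exact ⟨⟨(s ^ n) x, x, rfl⟩, LinearMap.congr_fun (hπn n) x⟩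

variable [IsArtinianRing A] [IsNoetherianRing A]

/-- Finitely generated modules over an artinian ring have projective covers. -/
theorem exists_projectiveCover (M : Type u) [AddCommGroup M] [Module A M] [Module.Finite A M] :
    ∃ (P : ModuleCat.{u} A) (π : P →ₗ[A] M), Module.Finite A P ∧ Module.Projective A P ∧
      Function.Surjective π ∧ IsSuperfluous (LinearMap.ker π) := by
  obtain ⟨n, π, hπ⟩ := Module.Finite.exists_fin' A M
  -- Descent through the projective submodules of a free module that still surject onto `M`: as long
  -- as the kernel is not superfluous, a smaller one exists, and the artinian condition stops the
  -- descent.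
  suffices H : ∀ U : Submodule A (Fin n → A), Module.Projective A U →
      Function.Surjective (π ∘ₗ U.subtype) → ∃ (P : ModuleCat.{u} A) (π : P →ₗ[A] M),
      Module.Finite A P ∧ Module.Projective A P ∧ Function.Surjective π ∧
        IsSuperfluous (LinearMap.ker π) by
    refine H ⊤ (Module.Projective.of_equiv Submodule.topEquiv.symm) fun m => ?_
    obtain ⟨x, rfl⟩ := hπ m
    exact ⟨⟨x, trivial⟩, rfl⟩
  intro U
  induction U using WellFoundedLT.induction with
  | ind U ih =>
    intro hU hs
    by_cases hsup : IsSuperfluous (LinearMap.ker (π ∘ₗ U.subtype))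
    · exact ⟨ModuleCat.of A U, π ∘ₗ U.subtype, inferInstanceAs (Module.Finite A U), hU, hs, hsup⟩
    · obtain ⟨W, hW, hWp, hWs⟩ := exists_lt_summand_of_not_isSuperfluous hs hsup
      have e := Submodule.equivMapOfInjective U.subtype U.injective_subtype W
      refine ih (W.map U.subtype) (lt_of_le_of_ne (Submodule.map_subtype_le U W) ?_)
        (Module.Projective.of_equiv e) ?_
      · intro h
        refine hW (Submodule.map_injective_of_injective U.injective_subtype ?_)
        rw [h, Submodule.map_subtype_top]
      · intro m
        obtain ⟨w, rfl⟩ := hWs m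
        exact ⟨⟨_, w, w.2, rfl⟩, rfl⟩

theorem exists_isMinProjPres (M : Type u) [AddCommGroup M] [Module A M] [Module.Finite A M] :
    ∃ (P₁ P₀ : ModuleCat.{u} A) (d : P₁ →ₗ[A] P₀) (π : P₀ →ₗ[A] M), IsMinProjPres d π := by
  obtain ⟨P₀, π, hf₀, hp₀, hs₀, hm₀⟩ := exists_projectiveCover (A := A) M
  obtain ⟨P₁, ρ, hf₁, hp₁, hs₁, hm₁⟩ := exists_projectiveCover (A := A) (LinearMap.ker π)
  refine ⟨P₁, P₀, (LinearMap.ker π).subtype ∘ₗ ρ, π, hf₁, hf₀, hp₁, hp₀, hs₀, ?_, hm₀, ?_⟩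
  · intro x
    constructor
    · intro hx
      obtain ⟨y, hy⟩ := hs₁ ⟨x, hx⟩
      exact ⟨y, congrArg Subtype.val hy⟩
    · rintro ⟨y, rfl⟩
      exact (ρ y).2
  · rwa [LinearMap.ker_comp_of_ker_eq_bot _ (Submodule.ker_subtype _)]

end Existence

/-! ### Multiplicities in finitely generated projective modules -/

section Multiplicity

variable {A : Type u} [Ring A] {n : ℕ} {P : Fin n → ModuleCat.{u} A}

/-- `⨁ᵢ (P i)^{aᵢ + bᵢ}` splits as a product. -/
def powAddEquiv (P : Fin n → ModuleCat.{u} A) (a b : Fin n → ℕ) :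
    ((i : Fin n) → Fin (a i + b i) → P i) ≃ₗ[A]
      ((i : Fin n) → Fin (a i) → P i) × ((i : Fin n) → Fin (b i) → P i) where
  toFun f := (fun i k => f i (Fin.castAdd _ k), fun i k => f i (Fin.natAdd _ k))
  invFun f i := Fin.addCases (f.1 i) (f.2 i)
  map_add' _ _ := rfl
  map_smul' _ _ := rfl
  left_inv f := by
    funext i k
    induction k using Fin.addCases <;> simp
  right_inv f := by ext <;> simp

/-- Well-founded induction over the projective submodules of `Q`: a nonzero one is either
indecomposable, hence in the list, or splits into two strictly smaller summands whose multiplicities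
add. -/
theorem IsProjIndecList.exists_equiv [IsArtinianRing A] [IsNoetherianRing A]
    (hP : IsProjIndecList P) (Q : Type u) [AddCommGroup Q] [Module A Q] [Module.Finite A Q]
    [Module.Projective A Q] :
    ∃ a : Fin n → ℕ, Nonempty (Q ≃ₗ[A] ((i : Fin n) → Fin (a i) → P i)) := by
  suffices H : ∀ U : Submodule A Q, Module.Projective A U →
      ∃ a : Fin n → ℕ, Nonempty (U ≃ₗ[A] ((i : Fin n) → Fin (a i) → P i)) by
    obtain ⟨a, ⟨e⟩⟩ := H ⊤ (Module.Projective.of_equiv Submodule.topEquiv.symm)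
    exact ⟨a, ⟨Submodule.topEquiv.symm.trans e⟩⟩
  intro U
  induction U using WellFoundedLT.induction with
  | ind U ih =>
    intro hU
    rcases subsingleton_or_nontrivial U with hsub | hnt
    · have : ∀ i : Fin n, IsEmpty (Fin ((0 : Fin n → ℕ) i)) := fun _ => Fin.isEmpty
      exact ⟨0, ⟨LinearEquiv.ofSubsingleton _ _⟩⟩
    by_cases hi : IsIndecomposable A U
    · obtain ⟨i, ⟨e⟩⟩ := hP.complete (ModuleCat.of A U) (inferInstanceAs (Module.Finite A U)) hU hi
      refine ⟨Pi.single i 1, ⟨e.trans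
        { toFun := fun x j k => if h : j = i then h ▸ x else 0
          map_add' := fun x y => ?_
          map_smul' := fun r x => ?_
          invFun := fun f => f i ⟨0, by simp⟩
          left_inv := fun x => by simp
          right_inv := fun f => ?_ }⟩⟩
      · funext j k
        by_cases h : j = i
        · subst h; simp
        · simp [h]
      · funext j k
        by_cases h : j = i
        · subst h; simp
        · simp [h]
      · funext j k
        by_cases h : j = i
        · subst h
          have hk : k = ⟨0, by simp⟩ := by
            have : Subsingleton (Fin ((Pi.single j 1 : Fin n → ℕ) j)) := by
              rw [Pi.single_eq_same]
              infer_instance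
            exact Subsingleton.elim _ _
          simp [hk]
        · have := k.2
          simp [h] at this
    · have hex : ∃ V W : Submodule A U, IsCompl V W ∧ V ≠ ⊥ ∧ W ≠ ⊥ := by
        by_contra hno
        push Not at hno
        exact hi ⟨hnt, fun V W hVW => or_iff_not_imp_left.2 (hno V W hVW)⟩
      obtain ⟨V, W, hVW, hV, hW⟩ := hex
      have key : ∀ V W : Submodule A U, IsCompl V W → W ≠ ⊥ →
          ∃ a : Fin n → ℕ, Nonempty (V ≃ₗ[A] ((i : Fin n) → Fin (a i) → P i)) := by
        intro V W hVW hW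
        have e := Submodule.equivMapOfInjective U.subtype U.injective_subtype V
        have hVp : Module.Projective A V :=
          Module.Projective.of_split (Submodule.subtype _) (Submodule.projectionOnto _ _ hVW)
            (Submodule.projectionOnto_comp_subtype hVW)
        have hlt : V.map U.subtype < U := by
          refine lt_of_le_of_ne (Submodule.map_subtype_le U V) fun h => ?_
          have hVt : V = ⊤ := Submodule.map_injective_of_injective U.injective_subtype (by
            rw [h, Submodule.map_subtype_top])
          subst hVt
          exact hW (top_disjoint.1 hVW.disjoint)
        obtain ⟨a, ⟨f⟩⟩ := ih (V.map U.subtype) hlt (Module.Projective.of_equiv e)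
        exact ⟨a, ⟨e.trans f⟩⟩
      obtain ⟨a, ⟨f⟩⟩ := key V W hVW hW
      obtain ⟨b, ⟨g⟩⟩ := key W V hVW.symm hV
      exact ⟨a + b, ⟨(Submodule.prodEquivOfIsCompl V W hVW).symm.trans
        ((f.prodCongr g).trans (powAddEquiv P a b).symm)⟩⟩

/-- An indecomposable projective module that maps nontrivially to a simple quotient of an
indecomposable projective module of finite length is isomorphic to the latter. -/
theorem nonempty_equiv_of_hom_simple_ne_zero {P Q S : Type u} [AddCommGroup P] [Module A P]
    [AddCommGroup Q] [Module A Q] [AddCommGroup S] [Module A S] [IsArtinian A Q]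
    [IsNoetherian A Q] [Module.Projective A P] [Module.Projective A Q]
    (hP : IsIndecomposable A P) (hQ : IsIndecomposable A Q) [IsSimpleModule A S]
    {q : Q →ₗ[A] S} (hq : q ≠ 0) {f : P →ₗ[A] S} (hf : f ≠ 0) : Nonempty (P ≃ₗ[A] Q) := by
  obtain ⟨r, hr⟩ := Module.projective_lifting_property q f (LinearMap.surjective_of_ne_zero hq)
  obtain ⟨i, hi⟩ := Module.projective_lifting_property f q (LinearMap.surjective_of_ne_zero hf)
  -- Since `q h = q ≠ 0`, no power of `h` vanishes. Fitting's lemma and the indecomposability of `Q`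
  -- then make `h` bijective.
  set h : Module.End A Q := r ∘ₗ i with hh
  have hqh : q ∘ₗ h = q := by rw [hh, ← LinearMap.comp_assoc, hr, hi]
  have hqn : ∀ n : ℕ, q ∘ₗ (h ^ n) = q := by
    intro n
    induction n with
    | zero => rfl
    | succ n ih => rw [pow_succ, Module.End.mul_eq_comp, ← LinearMap.comp_assoc, ih, hqh]
  obtain ⟨n, hn, hc⟩ := ((Filter.eventually_ge_atTop 1).and
    (LinearMap.eventually_isCompl_ker_pow_range_pow h)).exists
  have hker : LinearMap.ker (h ^ n) = ⊥ := by
    refine (hQ.2 _ _ hc).resolve_right fun h0 => hq ?_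
    rw [← hqn n, LinearMap.range_eq_bot.1 h0, LinearMap.comp_zero]
  have hrange : LinearMap.range (h ^ n) = ⊤ := by
    rw [hker] at hc
    exact eq_top_of_bot_isCompl hc
  obtain ⟨k, rfl⟩ := Nat.exists_eq_add_of_le hn
  have hinj : Function.Injective h := by
    refine (LinearMap.ker_eq_bot (f := h)).1 (le_bot_iff.1 (hker ▸ fun x hx => ?_))
    rw [LinearMap.mem_ker] at hx ⊢
    rw [add_comm, pow_succ, Module.End.mul_apply, hx, map_zero]
  have hsurj : Function.Surjective h := by
    intro y
    obtain ⟨x, hx⟩ := LinearMap.range_eq_top.1 hrange y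
    rw [pow_add, pow_one, Module.End.mul_apply] at hx
    exact ⟨_, hx⟩
  -- As `r i` is bijective, `i` embeds `Q` as a complement of `ker r`; indecomposability of `P` then
  -- forces `ker r = 0`.
  have hcompl : IsCompl (LinearMap.range i) (LinearMap.ker r) := by
    constructor
    · rw [Submodule.disjoint_def]
      rintro _ ⟨x, rfl⟩ hx
      have : h x = h 0 := by rw [map_zero]; exact hx
      rw [hinj this, map_zero]
    · rw [codisjoint_iff, eq_top_iff]
      intro x _
      obtain ⟨y, hy⟩ := hsurj (r x)
      refine Submodule.mem_sup.2 ⟨i y, ⟨y, rfl⟩, x - i y, ?_, add_sub_cancel _ _⟩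
      rw [LinearMap.mem_ker, map_sub, ← hy]
      exact sub_self _
  have hkr : LinearMap.ker r = ⊥ := by
    refine (hP.2 _ _ hcompl).resolve_left fun h0 => hq ?_
    rw [← hi, LinearMap.range_eq_bot.1 h0, LinearMap.comp_zero]
  refine ⟨LinearEquiv.ofBijective r ⟨LinearMap.ker_eq_bot.1 hkr, fun y => ?_⟩⟩
  obtain ⟨x, hx⟩ := hsurj y
  exact ⟨i x, hx⟩

theorem finite_linearMap_of_finite (K : Type u) [Field K] (Q S : Type u) [AddCommGroup Q]
    [Module A Q] [Module.Finite A Q] [AddCommGroup S] [Module A S] [Module K S]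
    [SMulCommClass A K S] [Module.Finite K S] : Module.Finite K (Q →ₗ[A] S) := by
  obtain ⟨n, f, hf⟩ := Module.Finite.exists_fin' A Q
  let g : (Q →ₗ[A] S) →ₗ[K] (Fin n → S) :=
    { toFun := fun h k => h (f (Pi.single k 1))
      map_add' := fun _ _ => rfl
      map_smul' := fun _ _ => rfl }
  refine Module.Finite.of_injective g fun h h' hh => ?_
  refine (LinearMap.cancel_right hf).1 ?_
  refine LinearMap.pi_ext' fun k => LinearMap.ext_ring ?_
  exact congrFun hh k

/-- The multiplicities of the indecomposable projective modules are well defined. -/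
theorem IsProjIndecList.multiplicity_unique (K : Type u) [Field K] [Algebra K A]
    [Module.Finite K A] (hP : IsProjIndecList P) {a b : Fin n → ℕ}
    (e : ((i : Fin n) → Fin (a i) → P i) ≃ₗ[A] ((i : Fin n) → Fin (b i) → P i)) : a = b := by
  funext j
  have : IsArtinianRing A := IsArtinianRing.of_finite K A
  have : IsNoetherianRing A := IsNoetherianRing.of_finite K A
  have := hP.finite
  have := hP.projective
  have := (hP.indecomposable j).1
  -- The simple quotient `S` of `P j` receives no nonzero map from `P i` for `i ≠ j`, so `dim Hom(-,
  -- S)` of a direct sum is the multiplicity of `P j` times the nonzero number `dim Hom(P j, S)`.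
  obtain ⟨N, hN⟩ := IsCoatomic.exists_coatom (α := Submodule A (P j))
  let S := (P j) ⧸ N
  have : IsSimpleModule A S := isSimpleModule_iff_isCoatom.2 hN
  let : Module K S := Module.compHom S (algebraMap K A)
  have : IsScalarTower K A S := ⟨fun k x s => by
    rw [Algebra.smul_def, mul_smul]; rfl⟩
  have : SMulCommClass A K S := ⟨fun x k s => by
    change x • (algebraMap K A k • s) = algebraMap K A k • (x • s)
    rw [← mul_smul, ← mul_smul, Algebra.commutes]⟩
  have : Module.Finite K S := Module.Finite.trans A S
  have : ∀ i, Module.Finite K (P i →ₗ[A] S) := fun i => finite_linearMap_of_finite K _ _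
  have hzero : ∀ i, i ≠ j → Module.finrank K (P i →ₗ[A] S) = 0 := by
    intro i hij
    have : Subsingleton (P i →ₗ[A] S) := by
      refine subsingleton_of_forall_eq 0 fun f => by_contra fun hf => hij (hP.injective i j ?_)
      refine nonempty_equiv_of_hom_simple_ne_zero (S := S) (q := N.mkQ) (hP.indecomposable i)
        (hP.indecomposable j) (fun h => hN.1 ?_) hf
      rw [← N.ker_mkQ, h, LinearMap.ker_zero]
    exact Module.finrank_zero_of_subsingleton
  have hpos : Module.finrank K (P j →ₗ[A] S) ≠ 0 := by
    intro h
    have := Module.finrank_zero_iff.1 h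
    have h0 : N.mkQ = 0 := Subsingleton.elim (α := P j →ₗ[A] S) _ _
    exact hN.1 (by rw [← N.ker_mkQ, h0, LinearMap.ker_zero])
  have hrank : ∀ c : Fin n → ℕ, Module.finrank K (((i : Fin n) → Fin (c i) → P i) →ₗ[A] S)
      = c j * Module.finrank K (P j →ₗ[A] S) := by
    intro c
    have e₁ := LinearMap.lsum A (fun i : Fin n => Fin (c i) → P i) K (M := S)
    have e₂ : ∀ i, _ := fun i => LinearMap.lsum A (fun _ : Fin (c i) => (P i : Type u)) K (M := S)
    have e₃ := (LinearEquiv.piCongrRight e₂).trans e₁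
    rw [← e₃.finrank_eq, Module.finrank_pi_fintype]
    simp only [Module.finrank_pi_fintype, Finset.sum_const, Finset.card_univ, Fintype.card_fin,
      smul_eq_mul]
    rw [Finset.sum_eq_single j (fun i _ hi => by rw [hzero i hi, mul_zero]) (by simp)]
  have h : Module.finrank K (((i : Fin n) → Fin (a i) → P i) →ₗ[A] S)
      = Module.finrank K (((i : Fin n) → Fin (b i) → P i) →ₗ[A] S) :=
    (LinearEquiv.finrank_eq
      { toFun := fun f => f ∘ₗ e.symm.toLinearMap
        map_add' := fun _ _ => rfl
        map_smul' := fun _ _ => rfl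
        invFun := fun f => f ∘ₗ e.toLinearMap
        left_inv := fun f => by ext; simp
        right_inv := fun f => by ext; simp })
  rw [hrank, hrank] at h
  exact Nat.eq_of_mul_eq_mul_right (Nat.pos_of_ne_zero hpos) h

end Multiplicity

/-! ### A criterion for `Hom(M, τ M) = 0` -/

section TauCriterion

/-- Every map `P₁ → P₀` is of the form `a d + d b` with endomorphisms `a` of `P₀` and `b` of
`P₁`, i.e. `d` has no self-extensions as a two-term complex. -/
def IsRigidMap {A P₁ P₀ : Type u} [Ring A] [AddCommGroup P₁] [Module A P₁] [AddCommGroup P₀]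
    [Module A P₀] (d : P₁ →ₗ[A] P₀) : Prop :=
  ∀ h : P₁ →ₗ[A] P₀, ∃ (a : P₀ →ₗ[A] P₀) (b : P₁ →ₗ[A] P₁), h = a ∘ₗ d + d ∘ₗ b

variable {A : Type u} [Ring A]

theorem exists_dualBasis (P : Type u) [AddCommGroup P] [Module A P] [Module.Finite A P]
    [Module.Projective A P] :
    ∃ (n : ℕ) (x : Fin n → P) (φ : Fin n → P →ₗ[A] A), ∀ p, ∑ i, φ i p • x i = p := by
  obtain ⟨n, f, hf⟩ := Module.Finite.exists_fin' A P
  obtain ⟨s, hs⟩ := Module.projective_lifting_property f LinearMap.id hf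
  refine ⟨n, fun i => f (Pi.single i 1), fun i => LinearMap.proj i ∘ₗ s, fun p => ?_⟩
  conv_rhs => rw [← LinearMap.id_apply (R := A) p, ← hs, LinearMap.comp_apply,
    pi_eq_sum_univ (s p), map_sum]
  refine Finset.sum_congr rfl fun i _ => ?_
  rw [LinearMap.comp_apply, LinearMap.proj_apply, ← map_smul]
  congr 2
  funext j
  simp [Pi.single_apply, eq_comm]

variable (K : Type u) [Field K] [Algebra K A]
  {P₁ P₀ M N : Type u} [AddCommGroup P₁] [Module A P₁] [AddCommGroup P₀] [Module A P₀]
  [AddCommGroup M] [Module A M] [AddCommGroup N] [Module A N]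

/-- The pairing of `N` and `Hom_A(P₁, A)` given by a homomorphism `N → τ M`. -/
def arPairing {d : P₁ →ₗ[A] P₀} (f : N →ₗ[A] ARTranslate K d) (x : N) (φ : P₁ →ₗ[A] A) : K :=
  (show Transpose d →ₗ[K] K from f x) (Submodule.Quotient.mk φ)

section arPairing

variable {K} {d : P₁ →ₗ[A] P₀} (f : N →ₗ[A] ARTranslate K d)

theorem arPairing_add_left (x y : N) (φ : P₁ →ₗ[A] A) :
    arPairing K f (x + y) φ = arPairing K f x φ + arPairing K f y φ :=
  congrArg (fun g : ARTranslate K d => (show Transpose d →ₗ[K] K from g) (Submodule.Quotient.mk φ))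
    (map_add f x y)

theorem arPairing_sum_left {κ : Type*} (s : Finset κ) (x : κ → N) (φ : P₁ →ₗ[A] A) :
    arPairing K f (∑ i ∈ s, x i) φ = ∑ i ∈ s, arPairing K f (x i) φ :=
  map_sum (AddMonoidHom.mk' (fun x => arPairing K f x φ) fun x y => arPairing_add_left f x y φ) x s

theorem arPairing_sum_right {κ : Type*} (s : Finset κ) (x : N) (φ : κ → P₁ →ₗ[A] A) :
    arPairing K f x (∑ i ∈ s, φ i) = ∑ i ∈ s, arPairing K f x (φ i) := by
  have h : (Submodule.Quotient.mk (∑ i ∈ s, φ i) : Transpose d)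
      = ∑ i ∈ s, Submodule.Quotient.mk (φ i) :=
    map_sum (Submodule.mkQ (LinearMap.range (homDual d))) φ s
  unfold arPairing
  rw [h, map_sum]

theorem arPairing_smul_left (a : A) (x : N) (φ : P₁ →ₗ[A] A) :
    arPairing K f (a • x) φ = arPairing K f x (MulOpposite.op a • φ) :=
  congrArg (fun g : ARTranslate K d => (show Transpose d →ₗ[K] K from g) (Submodule.Quotient.mk φ))
    (map_smul f a x)

theorem arPairing_comp (x : N) (ψ : P₀ →ₗ[A] A) : arPairing K f x (ψ ∘ₗ d) = 0 := by
  have h : (Submodule.Quotient.mk (ψ ∘ₗ d) : Transpose d) = 0 :=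
    (Submodule.Quotient.mk_eq_zero _).2 ⟨ψ, rfl⟩
  unfold arPairing
  rw [h, map_zero]

end arPairing

/-- One half of the duality between `Hom(N, τM)` and the cokernel of `Hom(d, N)`. By dual bases, `f`
yields the functional `h ↦ ∑ ⟨h xᵢ, φᵢ⟩` on `Hom(P₁, N)`, which kills every map factoring through
`d`. Its value at the rank one map `p ↦ θ(p) z` is the pairing of `z` and `θ`. -/
theorem eq_zero_of_comp_surjective [Module.Finite A P₁] [Module.Projective A P₁]
    [Module.Finite A P₀] [Module.Projective A P₀] (d : P₁ →ₗ[A] P₀)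
    (H : ∀ h : P₁ →ₗ[A] N, ∃ g : P₀ →ₗ[A] N, h = g ∘ₗ d) (f : N →ₗ[A] ARTranslate K d) :
    f = 0 := by
  obtain ⟨n, x, φ, hx⟩ := exists_dualBasis (A := A) P₁
  obtain ⟨m, y, ψ, hy⟩ := exists_dualBasis (A := A) P₀
  have hdual : ∀ θ : P₁ →ₗ[A] A, ∑ i, MulOpposite.op (θ (x i)) • φ i = θ := by
    intro θ
    ext p
    conv_rhs => rw [← hx p, map_sum]
    simp [LinearMap.sum_apply]
  have hzero : ∀ h : P₁ →ₗ[A] N, ∑ i, arPairing K f (h (x i)) (φ i) = 0 := by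
    intro h
    obtain ⟨g, rfl⟩ := H h
    have h1 : ∀ i, arPairing K f ((g ∘ₗ d) (x i)) (φ i)
        = ∑ j, arPairing K f (g (y j)) (MulOpposite.op (ψ j (d (x i))) • φ i) := by
      intro i
      rw [LinearMap.comp_apply, ← hy (d (x i)), map_sum, arPairing_sum_left, hy]
      refine Finset.sum_congr rfl fun j _ => ?_
      rw [map_smul, arPairing_smul_left]
    simp only [h1]
    rw [Finset.sum_comm]
    refine Finset.sum_eq_zero fun j _ => ?_
    rw [← arPairing_sum_right]
    have := hdual (ψ j ∘ₗ d)
    simp only [LinearMap.comp_apply] at this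
    rw [this, arPairing_comp]
  refine LinearMap.ext fun z => ?_
  refine LinearMap.ext (M := Transpose d) (M₃ := K) fun t => ?_
  obtain ⟨θ, rfl⟩ := Submodule.Quotient.mk_surjective _ t
  change arPairing K f z θ = 0
  have h2 := hzero (LinearMap.toSpanSingleton A N z ∘ₗ θ)
  simp only [LinearMap.comp_apply, LinearMap.toSpanSingleton_apply, arPairing_smul_left] at h2
  rwa [← arPairing_sum_right, hdual] at h2

/-- The other half of the duality. If `h` does not factor through `d`, some `K`-linear functional
`ℓ` kills all maps factoring through `d` but not `h`. Then `(z, θ) ↦ ℓ(θ(-) z)` defines a map `N →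
τM`. It vanishes by hypothesis, and since rank one maps span `Hom(P₁, N)`, so does `ℓ`, a
contradiction. -/
theorem comp_surjective_of_forall_eq_zero [Module.Finite A P₁] [Module.Projective A P₁]
    (d : P₁ →ₗ[A] P₀) (H : ∀ f : N →ₗ[A] ARTranslate K d, f = 0) (h : P₁ →ₗ[A] N) :
    ∃ g : P₀ →ₗ[A] N, h = g ∘ₗ d := by
  obtain ⟨n, x, φ, hx⟩ := exists_dualBasis (A := A) P₁
  let : Module K N := Module.compHom N (algebraMap K A)
  have hK : ∀ (k : K) (z : N), k • z = algebraMap K A k • z := fun _ _ => rfl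
  have : IsScalarTower K A N := ⟨fun k x s => by
    rw [Algebra.smul_def, mul_smul]; rfl⟩
  have : SMulCommClass A K N := ⟨fun x k s => by
    rw [hK, hK, ← mul_smul, ← mul_smul, Algebra.commutes]⟩
  let c : (P₀ →ₗ[A] N) →ₗ[K] (P₁ →ₗ[A] N) :=
    { toFun := fun g => g ∘ₗ d
      map_add' := fun _ _ => rfl
      map_smul' := fun _ _ => rfl }
  by_contra hno
  have hmem : h ∉ LinearMap.range c := fun ⟨g, hg⟩ => hno ⟨g, hg.symm⟩
  obtain ⟨ℓ, hℓ, hle⟩ := Submodule.exists_le_ker_of_notMem hmem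
  have hvan : ∀ g : P₀ →ₗ[A] N, ℓ (g ∘ₗ d) = 0 := fun g => hle ⟨g, rfl⟩
  let L : N → (P₁ →ₗ[A] A) →ₗ[K] K := fun z =>
    { toFun := fun θ => ℓ (LinearMap.toSpanSingleton A N z ∘ₗ θ)
      map_add' := fun θ θ' => by rw [LinearMap.comp_add, map_add]
      map_smul' := fun k θ => by
        have : LinearMap.toSpanSingleton A N z ∘ₗ (k • θ)
            = k • (LinearMap.toSpanSingleton A N z ∘ₗ θ) := by
          ext p
          simp
        rw [this, map_smul]
        rfl }
  let R := LinearMap.range (homDual d)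
  have hL : ∀ z, R.restrictScalars K ≤ LinearMap.ker (L z) := by
    rintro z _ ⟨ψ, rfl⟩
    exact hvan (LinearMap.toSpanSingleton A N z ∘ₗ ψ)
  let F : N → (Transpose d →ₗ[K] K) := fun z =>
    (R.restrictScalars K).liftQ (L z) (hL z) ∘ₗ
      (Submodule.Quotient.restrictScalarsEquiv K R).symm.toLinearMap
  have hF : ∀ z θ, F z (Submodule.Quotient.mk θ) = ℓ (LinearMap.toSpanSingleton A N z ∘ₗ θ) :=
    fun _ _ => rfl
  let f : N →ₗ[A] ARTranslate K d :=
    { toFun := F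
      map_add' := fun z w => by
        refine LinearMap.ext (M := Transpose d) (M₃ := K) fun t => ?_
        obtain ⟨θ, rfl⟩ := Submodule.Quotient.mk_surjective _ t
        refine (hF _ _).trans (Eq.trans ?_ (congrArg₂ (· + ·) (hF z θ).symm (hF w θ).symm))
        rw [← map_add]
        congr 1
        ext p
        simp
      map_smul' := fun a z => by
        refine LinearMap.ext (M := Transpose d) (M₃ := K) fun t => ?_
        obtain ⟨θ, rfl⟩ := Submodule.Quotient.mk_surjective _ t
        refine (hF _ _).trans (Eq.trans ?_ (hF z (MulOpposite.op a • θ)).symm)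
        congr 1
        ext p
        simp [mul_smul] }
  have hf := H f
  have hF0 : ∀ z θ, ℓ (LinearMap.toSpanSingleton A N z ∘ₗ θ) = 0 := fun z θ => by
    rw [← hF]
    have : F z = (0 : Transpose d →ₗ[K] K) := LinearMap.congr_fun hf z
    rw [this, LinearMap.zero_apply]
  apply hℓ
  have hsum : h = ∑ i, LinearMap.toSpanSingleton A N (h (x i)) ∘ₗ φ i := by
    ext p
    conv_lhs => rw [← hx p, map_sum]
    simp [LinearMap.sum_apply]
  rw [hsum, map_sum]
  exact Finset.sum_eq_zero fun i _ => hF0 _ _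

/-- By the duality for `N = M`, the left side says that every map `P₁ → M` factors through `d`.
Projectivity of `P₀` and `P₁` lifts this along `π`: if `π h = π a d`, then `h - a d` has image in
`ker π = im d` and so equals some `d b`. -/
theorem hom_arTranslate_eq_zero_iff_isRigidMap [Module.Finite A P₁] [Module.Projective A P₁]
    [Module.Finite A P₀] [Module.Projective A P₀] {d : P₁ →ₗ[A] P₀} {π : P₀ →ₗ[A] M}
    (hπ : Function.Surjective π) (hex : Function.Exact d π) :
    (∀ f : M →ₗ[A] ARTranslate K d, f = 0) ↔ IsRigidMap d := by
  have hπd : π ∘ₗ d = 0 := LinearMap.ext fun x => (hex _).2 ⟨x, rfl⟩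
  constructor
  · intro H h
    obtain ⟨g, hg⟩ := comp_surjective_of_forall_eq_zero K d H (π ∘ₗ h)
    obtain ⟨a, rfl⟩ := Module.projective_lifting_property π g hπ
    have hmem : ∀ x, (h - a ∘ₗ d) x ∈ LinearMap.range d := fun x => by
      refine (hex _).1 ?_
      have := LinearMap.congr_fun hg x
      simp only [LinearMap.comp_apply] at this
      simp [this]
    obtain ⟨b, hb⟩ := Module.projective_lifting_property d.rangeRestrict
      ((h - a ∘ₗ d).codRestrict _ hmem) d.surjective_rangeRestrict
    refine ⟨a, b, ?_⟩
    rw [← sub_eq_iff_eq_add']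
    ext x
    exact (congrArg Subtype.val (LinearMap.congr_fun hb x)).symm
  · intro H
    refine eq_zero_of_comp_surjective K d fun h => ?_
    obtain ⟨h', rfl⟩ := Module.projective_lifting_property π h hπ
    obtain ⟨a, b, rfl⟩ := H h'
    refine ⟨π ∘ₗ a, ?_⟩
    rw [LinearMap.comp_add, ← LinearMap.comp_assoc b, hπd, LinearMap.zero_comp, add_zero,
      LinearMap.comp_assoc]

theorem IsMinProjPres.hom_arTranslate_eq_zero_iff {d : P₁ →ₗ[A] P₀} {π : P₀ →ₗ[A] M}
    (h : IsMinProjPres d π) : (∀ f : M →ₗ[A] ARTranslate K d, f = 0) ↔ IsRigidMap d := by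
  have := h.finite₀
  have := h.finite₁
  have := h.projective₀
  have := h.projective₁
  exact hom_arTranslate_eq_zero_iff_isRigidMap K h.surjective h.exact

end TauCriterion

/-! ### Modules induced along a dual number extension -/

section Induced

/-- `B` is a free extension of `A` with basis `1, ε`, where `ε` is central with `ε² = 0`. -/
structure IsDualExtension {A B : Type u} [Ring A] [Ring B] (ι : A →+* B) (ε : B) : Prop where
  comm : ∀ b, ε * b = b * ε
  sq : ε * ε = 0
  bijective : Function.Bijective fun a : A × A => ι a.1 + ε * ι a.2

variable {A B : Type u} [Ring A] [Ring B] {ι : A →+* B} {ε : B}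

/-- `η` exhibits `N` as the `B`-module `M ⊕ ε M` induced from the `A`-module `M`. -/
def IsInduced (ε : B) {M N : Type u} [AddCommGroup M] [Module A M] [AddCommGroup N] [Module B N]
    (η : M →ₛₗ[ι] N) : Prop :=
  Function.Bijective fun x : M × M => η x.1 + ε • η x.2

/-- The `B`-linear map `F` between induced modules is `f₀ + ε f₁`. -/
def HasComponents (ε : B) {M N M' N' : Type u} [AddCommGroup M] [Module A M] [AddCommGroup N]
    [Module B N] [AddCommGroup M'] [Module A M'] [AddCommGroup N'] [Module B N']
    (η : M →ₛₗ[ι] N) (η' : M' →ₛₗ[ι] N') (F : N →ₗ[B] N') (f₀ f₁ : M →ₗ[A] M') : Prop :=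
  ∀ x, F (η x) = η' (f₀ x) + ε • η' (f₁ x)

variable {M N M' N' M'' N'' : Type u} [AddCommGroup M] [Module A M] [AddCommGroup N] [Module B N]
  [AddCommGroup M'] [Module A M'] [AddCommGroup N'] [Module B N']
  [AddCommGroup M''] [Module A M''] [AddCommGroup N''] [Module B N'']
  {η : M →ₛₗ[ι] N} {η' : M' →ₛₗ[ι] N'} {η'' : M'' →ₛₗ[ι] N''}

theorem isInduced_iff : IsInduced ε η ↔ (∀ x y, η x + ε • η y = 0 → x = 0 ∧ y = 0) ∧
    ∀ n, ∃ x y, η x + ε • η y = n := by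
  constructor
  · intro h
    refine ⟨fun x y hxy => ?_, fun n => ?_⟩
    · have : (x, y) = ((0, 0) : M × M) := h.1 (by simpa using hxy)
      exact Prod.ext_iff.1 this
    · obtain ⟨⟨x, y⟩, h⟩ := h.2 n
      exact ⟨x, y, h⟩
  · rintro ⟨h₁, h₂⟩
    constructor
    · rintro ⟨x, y⟩ ⟨x', y'⟩ h
      have h' : η x + ε • η y = η x' + ε • η y' := h
      obtain ⟨hx, hy⟩ := h₁ (x - x') (y - y') (by
        rw [map_sub, map_sub, smul_sub, ← sub_eq_zero.2 h']
        abel)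
      rw [sub_eq_zero.1 hx, sub_eq_zero.1 hy]
    · intro n
      obtain ⟨x, y, h⟩ := h₂ n
      exact ⟨(x, y), h⟩

theorem IsInduced.eq_and_eq (hη : IsInduced ε η) {x y x' y' : M}
    (h : η x + ε • η y = η x' + ε • η y') : x = x' ∧ y = y' :=
  Prod.ext_iff.1 (hη.1 (a₁ := (x, y)) (a₂ := (x', y')) h)

theorem IsInduced.eq_zero (hη : IsInduced ε η) {x y : M} (h : η x + ε • η y = 0) :
    x = 0 ∧ y = 0 :=
  (isInduced_iff.1 hη).1 x y h

theorem IsInduced.exists_eq (hη : IsInduced ε η) (n : N) : ∃ x y, η x + ε • η y = n :=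
  (isInduced_iff.1 hη).2 n

theorem IsInduced.hom_ext (hη : IsInduced ε η) {F G : N →ₗ[B] N'}
    (hFG : ∀ x, F (η x) = G (η x)) : F = G := by
  ext n
  obtain ⟨x, y, rfl⟩ := hη.exists_eq n
  simp [hFG]

theorem IsDualExtension.smul_smul_eq_zero (h : IsDualExtension ι ε) (n : N) : ε • ε • n = 0 := by
  rw [← mul_smul, h.sq, zero_smul]

theorem IsDualExtension.smul_comm (h : IsDualExtension ι ε) (b : B) (n : N) :
    ε • b • n = b • ε • n := by
  rw [← mul_smul, h.comm, mul_smul]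

theorem IsDualExtension.smul_add_smul (h : IsDualExtension ι ε) (f : M →ₛₗ[ι] N') (a a' : A)
    (x y : M) : (ι a + ε * ι a') • (f x + ε • f y)
      = f (a • x) + ε • f (a • y + a' • x) := by
  rw [map_add, map_smulₛₗ, map_smulₛₗ, map_smulₛₗ, add_smul, smul_add, smul_add, smul_add,
    mul_smul, mul_smul, ← h.smul_comm (ι a') (f y), h.smul_smul_eq_zero, h.smul_comm (ι a)]
  abel

/-- The universal property of induction: as `N = M ⊕ εM`, the only candidate is `x + εy ↦ f x + ε f
y`. -/
theorem IsInduced.exists_lift (h : IsDualExtension ι ε) (hη : IsInduced ε η) (f : M →ₛₗ[ι] N') :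
    ∃ F : N →ₗ[B] N', ∀ x, F (η x) = f x := by
  let e := Equiv.ofBijective _ hη
  let φ : N → N' := fun n => f (e.symm n).1 + ε • f (e.symm n).2
  have hφ : ∀ x y, φ (η x + ε • η y) = f x + ε • f y := by
    intro x y
    have : e.symm (η x + ε • η y) = (x, y) := e.symm_apply_apply (x, y)
    simp only [φ, this]
  refine ⟨{ toFun := φ, map_add' := fun n n' => ?_, map_smul' := fun b n => ?_ }, fun x => ?_⟩
  · obtain ⟨x, y, rfl⟩ := hη.exists_eq n
    obtain ⟨x', y', rfl⟩ := hη.exists_eq n'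
    have : η x + ε • η y + (η x' + ε • η y') = η (x + x') + ε • η (y + y') := by
      rw [map_add, map_add, smul_add]
      abel
    rw [this, hφ, hφ, hφ, map_add, map_add, smul_add]
    abel
  · obtain ⟨x, y, rfl⟩ := hη.exists_eq n
    obtain ⟨⟨a, a'⟩, rfl⟩ := h.bijective.2 b
    simp only [RingHom.id_apply]
    rw [h.smul_add_smul, hφ, hφ, h.smul_add_smul]
  · have := hφ x 0
    simpa using this

/-! ### Calculus of the components `f₀ + ε f₁` -/

namespace HasComponents

variable {F F' : N →ₗ[B] N'} {f₀ f₁ f₀' f₁' : M →ₗ[A] M'}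

theorem exists_hom (h : IsDualExtension ι ε) (hη : IsInduced ε η) (η' : M' →ₛₗ[ι] N')
    (f₀ f₁ : M →ₗ[A] M') : ∃ F : N →ₗ[B] N', HasComponents ε η η' F f₀ f₁ := by
  refine hη.exists_lift h (N' := N')
    { toFun := fun x => η' (f₀ x) + ε • η' (f₁ x), map_add' := fun x y => ?_,
      map_smul' := fun a x => ?_ }
  · simp only [map_add, smul_add]
    abel
  · simp only [map_smul, map_smulₛₗ, smul_add, h.smul_comm]

/-- Only the target has to be induced: the components are the coordinates of `F ∘ η`, and they are
`A`-linear because `ε` is central. -/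
theorem exists_components (η : M →ₛₗ[ι] N) (hη' : IsInduced ε η') (h : IsDualExtension ι ε)
    (F : N →ₗ[B] N') : ∃ f₀ f₁, HasComponents ε η η' F f₀ f₁ := by
  choose f₀ f₁ hf using fun x => hη'.exists_eq (F (η x))
  have hadd : ∀ x y, f₀ (x + y) = f₀ x + f₀ y ∧ f₁ (x + y) = f₁ x + f₁ y := by
    intro x y
    refine hη'.eq_and_eq ?_
    rw [hf, map_add η, map_add F, ← hf x, ← hf y, map_add, map_add, smul_add]
    abel
  have hsmul : ∀ (a : A) x, f₀ (a • x) = a • f₀ x ∧ f₁ (a • x) = a • f₁ x := by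
    intro a x
    refine hη'.eq_and_eq ?_
    rw [hf, map_smulₛₗ η, map_smul F, ← hf x, map_smulₛₗ, map_smulₛₗ, h.smul_comm, smul_add]
  exact ⟨⟨⟨f₀, fun x y => (hadd x y).1⟩, fun a x => (hsmul a x).1⟩,
    ⟨⟨f₁, fun x y => (hadd x y).2⟩, fun a x => (hsmul a x).2⟩, fun x => (hf x).symm⟩

theorem unique (hη' : IsInduced ε η') (hF : HasComponents ε η η' F f₀ f₁)
    (hF' : HasComponents ε η η' F f₀' f₁') : f₀ = f₀' ∧ f₁ = f₁' := by
  have H : ∀ x, f₀ x = f₀' x ∧ f₁ x = f₁' x := fun x =>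
    hη'.eq_and_eq ((hF x).symm.trans (hF' x))
  exact ⟨LinearMap.ext fun x => (H x).1, LinearMap.ext fun x => (H x).2⟩

theorem hom_unique (hη : IsInduced ε η)
    (hF : HasComponents ε η η' F f₀ f₁) (hF' : HasComponents ε η η' F' f₀ f₁) : F = F' :=
  hη.hom_ext fun x => (hF x).trans (hF' x).symm

theorem apply (h : IsDualExtension ι ε) (hF : HasComponents ε η η' F f₀ f₁) (x y : M) :
    F (η x + ε • η y) = η' (f₀ x) + ε • η' (f₁ x + f₀ y) := by
  rw [map_add, map_smul, hF, hF, map_add η', smul_add, smul_add, h.smul_smul_eq_zero]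
  abel

theorem apply_zero (h : IsDualExtension ι ε) (hF : HasComponents ε η η' F f₀ 0) (x y : M) :
    F (η x + ε • η y) = η' (f₀ x) + ε • η' (f₀ y) := by
  rw [hF.apply h, LinearMap.zero_apply, zero_add]

theorem add (hF : HasComponents ε η η' F f₀ f₁) (hF' : HasComponents ε η η' F' f₀' f₁') :
    HasComponents ε η η' (F + F') (f₀ + f₀') (f₁ + f₁') := fun x => by
  simp only [LinearMap.add_apply, map_add, smul_add, hF x, hF' x]
  abel

theorem comp (h : IsDualExtension ι ε) {G : N' →ₗ[B] N''} {g₀ g₁ : M' →ₗ[A] M''}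
    (hG : HasComponents ε η' η'' G g₀ g₁) (hF : HasComponents ε η η' F f₀ f₁) :
    HasComponents ε η η'' (G ∘ₗ F) (g₀ ∘ₗ f₀) (g₁ ∘ₗ f₀ + g₀ ∘ₗ f₁) := fun x => by
  rw [LinearMap.comp_apply, hF x, hG.apply h]
  rfl

theorem id (η : M →ₛₗ[ι] N) : HasComponents ε η η LinearMap.id LinearMap.id 0 := fun x => by
  simp

theorem zero (η : M →ₛₗ[ι] N) (η' : M' →ₛₗ[ι] N') : HasComponents ε η η' 0 0 0 := fun x => by
  simp

end HasComponents

/-! #### Isomorphisms and summands -/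

/-- Reduction modulo `ε`: the leading components of mutually inverse maps are mutually inverse. -/
theorem IsInduced.nonempty_equiv (h : IsDualExtension ι ε) (hη : IsInduced ε η)
    (hη' : IsInduced ε η') (e : N ≃ₗ[B] N') : Nonempty (M ≃ₗ[A] M') := by
  obtain ⟨f₀, f₁, hf⟩ := HasComponents.exists_components η hη' h e.toLinearMap
  obtain ⟨g₀, g₁, hg⟩ := HasComponents.exists_components η' hη h e.symm.toLinearMap
  refine ⟨LinearEquiv.ofLinearMap f₀ g₀ ?_ ?_⟩
  · exact ((hf.comp h hg).unique hη' (by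
      rw [LinearEquiv.comp_coe, LinearEquiv.symm_trans_self]
      exact HasComponents.id η')).1
  · exact ((hg.comp h hf).unique hη (by
      rw [LinearEquiv.comp_coe, LinearEquiv.self_trans_symm]
      exact HasComponents.id η)).1

theorem IsInduced.nonempty_equiv_of_equiv (h : IsDualExtension ι ε) (hη : IsInduced ε η)
    (hη' : IsInduced ε η') (e : M ≃ₗ[A] M') : Nonempty (N ≃ₗ[B] N') := by
  obtain ⟨F, hF⟩ := HasComponents.exists_hom h hη η' e.toLinearMap 0
  obtain ⟨G, hG⟩ := HasComponents.exists_hom h hη' η e.symm.toLinearMap 0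
  refine ⟨LinearEquiv.ofLinearMap F G ?_ ?_⟩
  · refine (hF.comp h hG).hom_unique hη' ?_
    simpa using HasComponents.id (ε := ε) η'
  · refine (hG.comp h hF).hom_unique hη ?_
    simpa using HasComponents.id (ε := ε) η

theorem IsInduced.isSummand_iff (h : IsDualExtension ι ε) (hη : IsInduced ε η)
    (hη' : IsInduced ε η') : IsSummand B N N' ↔ IsSummand A M M' := by
  constructor
  · rintro ⟨i, r, hir⟩
    obtain ⟨i₀, i₁, hi⟩ := HasComponents.exists_components η hη' h i
    obtain ⟨r₀, r₁, hr⟩ := HasComponents.exists_components η' hη h r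
    exact ⟨i₀, r₀, ((hr.comp h hi).unique hη (hir ▸ HasComponents.id η)).1⟩
  · rintro ⟨i, r, hir⟩
    obtain ⟨I, hI⟩ := HasComponents.exists_hom h hη η' i 0
    obtain ⟨R, hR⟩ := HasComponents.exists_hom h hη' η r 0
    refine ⟨I, R, (hR.comp h hI).hom_unique hη ?_⟩
    simpa [hir] using HasComponents.id (ε := ε) η

/-- A summand of an induced module is induced from a summand. -/
theorem IsInduced.exists_of_isSummand (h : IsDualExtension ι ε) (hη : IsInduced ε η)
    {Y : Type u} [AddCommGroup Y] [Module B Y] (hY : IsSummand B Y N) :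
    ∃ (X : ModuleCat.{u} A) (θ : X →ₛₗ[ι] Y), IsSummand A X M ∧ IsInduced ε θ := by
  obtain ⟨i, r, hir⟩ := hY
  have hri : ∀ y, r (i y) = y := fun y => LinearMap.congr_fun hir y
  -- The idempotent `i r = e₀ + ε e₁` cuts out `Y`, and `e₀` is idempotent by reduction modulo `ε`.
  -- The module inducing `Y` is the range of `e₀`, embedded by `x ↦ r (η x)`.
  obtain ⟨e₀, e₁, he⟩ := HasComponents.exists_components η hη h (i ∘ₗ r)
  have hidem : ∀ x, e₀ (e₀ x) = e₀ x := fun x => LinearMap.congr_fun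
    ((he.comp h he).unique hη (by
      rw [LinearMap.comp_assoc, ← LinearMap.comp_assoc r, hir, LinearMap.id_comp]
      exact he)).1 x
  have hr : ∀ x, r (η x) = r (η (e₀ x)) + ε • r (η (e₁ x)) := fun x => by
    rw [← map_smul, ← map_add, ← he x, LinearMap.comp_apply, hri]
  have hεr : ∀ x, ε • r (η x) = ε • r (η (e₀ x)) := fun x => by
    rw [hr x, smul_add, h.smul_smul_eq_zero, add_zero]
  have hfix : ∀ x ∈ LinearMap.range e₀, e₀ x = x := by
    rintro _ ⟨x, rfl⟩
    exact hidem x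
  let X := LinearMap.range e₀
  let θ : X →ₛₗ[ι] Y :=
    { toFun := fun x => r (η x)
      map_add' := fun x y => by simp
      map_smul' := fun a x => by simp }
  refine ⟨ModuleCat.of A X, θ, ⟨X.subtype, e₀.rangeRestrict, ?_⟩, isInduced_iff.2 ⟨?_, ?_⟩⟩
  · ext x
    exact hfix x.1 x.2
  · rintro ⟨x, hx⟩ ⟨y, hy⟩ hxy
    have hxy' : r (η x + ε • η y) = 0 := by
      rw [map_add, map_smul]
      exact hxy
    -- Applying `i` turns the relation into `e₀ x = 0` and `e₁ x + e₀ y = 0`, where `e₀` fixes `x`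
    -- and `y`.
    have h1 := he.apply h x y
    rw [LinearMap.comp_apply, hxy', map_zero, eq_comm] at h1
    obtain ⟨hx0, hy0⟩ := hη.eq_zero h1
    rw [hfix x hx] at hx0
    subst hx0
    rw [map_zero, zero_add, hfix y hy] at hy0
    subst hy0
    exact ⟨rfl, rfl⟩
  · intro y
    obtain ⟨m, m', hm⟩ := hη.exists_eq (i y)
    -- Expand `y = r (i y) = r (η m) + ε r (η m')` by `hr`; by `hεr`, inserting `e₀` under `ε`
    -- changes nothing.
    refine ⟨⟨e₀ m, m, rfl⟩, ⟨e₀ (e₁ m + m'), _, rfl⟩, ?_⟩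
    change r (η (e₀ m)) + ε • r (η (e₀ (e₁ m + m'))) = y
    rw [← hεr, ← hri y, ← hm, map_add r, map_smul, hr m, map_add η, map_add r, smul_add, add_assoc]

theorem isInduced_ringHom (h : IsDualExtension ι ε) :
    IsInduced ε (ι.toSemilinearMap : A →ₛₗ[ι] B) :=
  h.bijective

/-- The product of two semilinear maps. -/
def prodSemilinear (η : M →ₛₗ[ι] N) (η' : M' →ₛₗ[ι] N') : (M × M') →ₛₗ[ι] (N × N') where
  toFun x := (η x.1, η' x.2)
  map_add' x y := by simp
  map_smul' a x := by simp

theorem IsInduced.prod (hη : IsInduced ε η) (hη' : IsInduced ε η') :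
    IsInduced ε (prodSemilinear η η') := by
  refine isInduced_iff.2 ⟨?_, ?_⟩
  · rintro ⟨x, x'⟩ ⟨y, y'⟩ h
    have h1 := hη.eq_zero (congrArg Prod.fst h)
    have h2 := hη'.eq_zero (congrArg Prod.snd h)
    exact ⟨Prod.ext h1.1 h2.1, Prod.ext h1.2 h2.2⟩
  · rintro ⟨n, n'⟩
    obtain ⟨x, y, rfl⟩ := hη.exists_eq n
    obtain ⟨x', y', rfl⟩ := hη'.exists_eq n'
    exact ⟨(x, x'), (y, y'), rfl⟩

/-- The product of a family of semilinear maps. -/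
def piSemilinear {κ : Type} {X Y : κ → Type u} [∀ i, AddCommGroup (X i)] [∀ i, Module A (X i)]
    [∀ i, AddCommGroup (Y i)] [∀ i, Module B (Y i)] (η : ∀ i, X i →ₛₗ[ι] Y i) :
    (∀ i, X i) →ₛₗ[ι] (∀ i, Y i) where
  toFun x i := η i (x i)
  map_add' x y := by
    funext i
    simp
  map_smul' a x := by
    funext i
    simp

theorem IsInduced.pi {κ : Type} {X Y : κ → Type u} [∀ i, AddCommGroup (X i)]
    [∀ i, Module A (X i)] [∀ i, AddCommGroup (Y i)] [∀ i, Module B (Y i)]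
    {η : ∀ i, X i →ₛₗ[ι] Y i} (hη : ∀ i, IsInduced ε (η i)) : IsInduced ε (piSemilinear η) := by
  refine isInduced_iff.2 ⟨fun x y h => ?_, fun n => ?_⟩
  · have h1 := fun i => (hη i).eq_zero (congrFun h i)
    exact ⟨funext fun i => (h1 i).1, funext fun i => (h1 i).2⟩
  · choose x y hxy using fun i => (hη i).exists_eq (n i)
    exact ⟨x, y, funext hxy⟩

theorem IsInduced.nontrivial_iff (hη : IsInduced ε η) : Nontrivial N ↔ Nontrivial M := by
  rw [← not_subsingleton_iff_nontrivial, ← not_subsingleton_iff_nontrivial, not_iff_not]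
  constructor
  · intro _
    exact subsingleton_of_forall_eq 0 fun x =>
      (hη.eq_zero (x := x) (y := 0) (Subsingleton.elim _ _)).1
  · intro _
    refine subsingleton_of_forall_eq 0 fun n => ?_
    obtain ⟨x, y, rfl⟩ := hη.exists_eq n
    rw [Subsingleton.elim x 0, Subsingleton.elim y 0]
    simp

/-- The form in terms of external products suits induced modules, which are known only up to
isomorphism. -/
theorem isIndecomposable_iff {A : Type u} [Ring A] {X : Type u} [AddCommGroup X] [Module A X] :
    IsIndecomposable A X ↔ Nontrivial X ∧ ∀ Y Z : ModuleCat.{u} A, (X ≃ₗ[A] Y × Z) →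
      ¬ Nontrivial Y ∨ ¬ Nontrivial Z := by
  refine and_congr_right fun _ => ⟨fun H Y Z e => ?_, fun H U V hUV => ?_⟩
  · let U := (LinearMap.range (LinearMap.inl A Y Z)).comap e.toLinearMap
    let V := (LinearMap.range (LinearMap.inr A Y Z)).comap e.toLinearMap
    have hUV : IsCompl U V :=
      (Submodule.orderIsoMapComap e).symm.isCompl LinearMap.isCompl_range_inl_inr
    refine (H U V hUV).imp (fun h hY => ?_) fun h hZ => ?_
    · obtain ⟨y, hy⟩ := exists_ne (0 : Y)
      have : e.symm (y, 0) ∈ U := ⟨y, by simp⟩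
      rw [h, Submodule.mem_bot, LinearEquiv.map_eq_zero_iff] at this
      exact hy (congrArg Prod.fst this)
    · obtain ⟨y, hy⟩ := exists_ne (0 : Z)
      have : e.symm (0, y) ∈ V := ⟨y, by simp⟩
      rw [h, Submodule.mem_bot, LinearEquiv.map_eq_zero_iff] at this
      exact hy (congrArg Prod.snd this)
  · refine (H (ModuleCat.of A U) (ModuleCat.of A V)
      (Submodule.prodEquivOfIsCompl U V hUV).symm).imp (fun h => ?_) fun h => ?_
    · exact Submodule.subsingleton_iff_eq_bot.1 (not_nontrivial_iff_subsingleton.1 h)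
    · exact Submodule.subsingleton_iff_eq_bot.1 (not_nontrivial_iff_subsingleton.1 h)

/-! #### Finiteness and projectivity -/

theorem IsInduced.finite (hη : IsInduced ε η) [Module.Finite A M] : Module.Finite B N := by
  obtain ⟨s, hs⟩ := Module.finite_def.1 (inferInstance : Module.Finite A M)
  classical
  refine ⟨⟨s.image η, top_le_iff.1 fun n _ => ?_⟩⟩
  have key : ∀ x, η x ∈ Submodule.span B (↑(s.image η) : Set N) := by
    intro x
    have hx : x ∈ Submodule.span A (s : Set M) := hs ▸ Submodule.mem_top
    induction hx using Submodule.span_induction with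
    | mem x hx => exact Submodule.subset_span (by simpa using ⟨x, hx, rfl⟩)
    | zero => rw [map_zero]; exact zero_mem _
    | add x y _ _ hx hy => rw [map_add]; exact add_mem hx hy
    | smul a x _ hx => rw [map_smulₛₗ]; exact Submodule.smul_mem _ _ hx
  obtain ⟨x, y, rfl⟩ := hη.exists_eq n
  exact add_mem (key x) (Submodule.smul_mem _ _ (key y))

theorem exists_semilinear_lift [Module.Projective A M] (g : N →ₗ[B] N')
    (hg : Function.Surjective g) (f : M →ₛₗ[ι] N') : ∃ f' : M →ₛₗ[ι] N, ∀ x, g (f' x) = f x := by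
  let : Module A N := Module.compHom N ι
  let : Module A N' := Module.compHom N' ι
  let gA : N →ₗ[A] N' :=
    { toFun := g, map_add' := map_add g, map_smul' := fun a n => map_smul g (ι a) n }
  let fA : M →ₗ[A] N' :=
    { toFun := f, map_add' := map_add f, map_smul' := fun a n => map_smulₛₗ f a n }
  obtain ⟨k, hk⟩ := Module.projective_lifting_property gA fA hg
  exact ⟨{ toFun := k, map_add' := map_add k, map_smul' := fun a n => map_smul k a n },
    fun x => LinearMap.congr_fun hk x⟩

theorem IsInduced.projective (h : IsDualExtension ι ε) (hη : IsInduced ε η)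
    [Module.Projective A M] : Module.Projective B N := by
  refine Module.Projective.of_lifting_property fun {X Y} _ _ _ _ f g hf => ?_
  obtain ⟨k, hk⟩ := exists_semilinear_lift f hf
    (⟨⟨fun x => g (η x), fun x y => by simp⟩, fun a x => by simp⟩ : M →ₛₗ[ι] Y)
  obtain ⟨F, hF⟩ := hη.exists_lift h k
  refine ⟨F, hη.hom_ext fun x => ?_⟩
  rw [LinearMap.comp_apply, hF, hk]
  rfl

theorem IsSummand.finite {A : Type u} [Ring A] {X M : Type u} [AddCommGroup X] [Module A X]
    [AddCommGroup M] [Module A M] [Module.Finite A M] (hX : IsSummand A X M) :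
    Module.Finite A X := by
  obtain ⟨i, r, h⟩ := hX
  exact Module.Finite.of_surjective r fun x => ⟨i x, LinearMap.congr_fun h x⟩

theorem IsSummand.projective {A : Type u} [Ring A] {X M : Type u} [AddCommGroup X] [Module A X]
    [AddCommGroup M] [Module A M] [Module.Projective A M] (hX : IsSummand A X M) :
    Module.Projective A X := by
  obtain ⟨i, r, h⟩ := hX
  exact Module.Projective.of_split i r h

/-- Every finitely generated projective `B`-module is induced. -/
theorem IsDualExtension.exists_of_projective (h : IsDualExtension ι ε) (Y : Type u)
    [AddCommGroup Y] [Module B Y] [Module.Finite B Y] [Module.Projective B Y] :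
    ∃ (X : ModuleCat.{u} A) (θ : X →ₛₗ[ι] Y), Module.Finite A X ∧ Module.Projective A X ∧
      IsInduced ε θ := by
  obtain ⟨n, f, hf⟩ := Module.Finite.exists_fin' B Y
  obtain ⟨s, hs⟩ := Module.projective_lifting_property f LinearMap.id hf
  obtain ⟨X, θ, hX, hθ⟩ := (IsInduced.pi (κ := Fin n) fun _ => isInduced_ringHom h).exists_of_isSummand
    h ⟨s, f, hs⟩
  exact ⟨X, θ, hX.finite, hX.projective, hθ⟩

/-- Both factors of a decomposition of `N` are induced, so the decomposition descends to one of `M`.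
-/
theorem IsInduced.isIndecomposable_of (h : IsDualExtension ι ε) (hη : IsInduced ε η)
    (hM : IsIndecomposable A M) : IsIndecomposable B N := by
  rw [isIndecomposable_iff] at hM ⊢
  refine ⟨hη.nontrivial_iff.2 hM.1, fun Y Z e => ?_⟩
  obtain ⟨Y', θ, -, hθ⟩ := hη.exists_of_isSummand h (Y := Y)
    ⟨e.symm.toLinearMap ∘ₗ LinearMap.inl B Y Z, LinearMap.fst B Y Z ∘ₗ e.toLinearMap, by ext; simp⟩
  obtain ⟨Z', θ', -, hθ'⟩ := hη.exists_of_isSummand h (Y := Z)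
    ⟨e.symm.toLinearMap ∘ₗ LinearMap.inr B Y Z, LinearMap.snd B Y Z ∘ₗ e.toLinearMap, by ext; simp⟩
  obtain ⟨e'⟩ := hη.nonempty_equiv h (hθ.prod hθ') e
  rw [hθ.nontrivial_iff, hθ'.nontrivial_iff]
  exact hM.2 Y' Z' e'

end Induced

/-! ### Presentations of induced modules -/

section InducedPresentation

variable {A B : Type u} [Ring A] [Ring B] {ι : A →+* B} {ε : B}
  {M N M' N' M'' N'' : Type u} [AddCommGroup M] [Module A M] [AddCommGroup N] [Module B N]
  [AddCommGroup M'] [Module A M'] [AddCommGroup N'] [Module B N']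
  [AddCommGroup M''] [Module A M''] [AddCommGroup N''] [Module B N'']
  {η : M →ₛₗ[ι] N} {η' : M' →ₛₗ[ι] N'} {η'' : M'' →ₛₗ[ι] N''}

namespace HasComponents

variable {F : N →ₗ[B] N'} {f : M →ₗ[A] M'} {G : N' →ₗ[B] N''} {g : M' →ₗ[A] M''}

theorem apply_eq_zero_iff (h : IsDualExtension ι ε) (hη' : IsInduced ε η')
    (hF : HasComponents ε η η' F f 0) (x y : M) :
    F (η x + ε • η y) = 0 ↔ f x = 0 ∧ f y = 0 := by
  rw [hF.apply_zero h]
  refine ⟨hη'.eq_zero, ?_⟩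
  rintro ⟨h1, h2⟩
  rw [h1, h2]
  simp

theorem mem_range_iff (h : IsDualExtension ι ε) (hη : IsInduced ε η) (hη' : IsInduced ε η')
    (hF : HasComponents ε η η' F f 0) (x y : M') :
    η' x + ε • η' y ∈ Set.range F ↔ x ∈ Set.range f ∧ y ∈ Set.range f := by
  constructor
  · rintro ⟨n, hn⟩
    obtain ⟨u, v, rfl⟩ := hη.exists_eq n
    rw [hF.apply_zero h] at hn
    obtain ⟨h1, h2⟩ := hη'.eq_and_eq hn
    exact ⟨⟨u, h1⟩, ⟨v, h2⟩⟩
  · rintro ⟨⟨u, rfl⟩, ⟨v, rfl⟩⟩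
    exact ⟨_, hF.apply_zero h u v⟩

theorem surjective_iff (h : IsDualExtension ι ε) (hη : IsInduced ε η) (hη' : IsInduced ε η')
    (hF : HasComponents ε η η' F f 0) : Function.Surjective F ↔ Function.Surjective f := by
  constructor
  · intro H x
    exact ((hF.mem_range_iff h hη hη' x 0).1 (H _)).1
  · intro H n
    obtain ⟨x, y, rfl⟩ := hη'.exists_eq n
    exact (hF.mem_range_iff h hη hη' x y).2 ⟨H x, H y⟩

theorem exact_iff (h : IsDualExtension ι ε) (hη : IsInduced ε η) (hη' : IsInduced ε η')
    (hη'' : IsInduced ε η'') (hF : HasComponents ε η η' F f 0)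
    (hG : HasComponents ε η' η'' G g 0) : Function.Exact F G ↔ Function.Exact f g := by
  constructor
  · intro H x
    have := H (η' x + ε • η' 0)
    rw [hG.apply_eq_zero_iff h hη'', hF.mem_range_iff h hη hη'] at this
    have h0 : (0 : M') ∈ Set.range f := ⟨0, map_zero f⟩
    simpa [h0] using this
  · intro H n
    obtain ⟨x, y, rfl⟩ := hη'.exists_eq n
    rw [hG.apply_eq_zero_iff h hη'', hF.mem_range_iff h hη hη', H x, H y]

/-- Nakayama's lemma for the nilpotent `ε`: the reduction `W` of `V` modulo `ε` is all of `M`, hence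
`εN ⊆ V`, and so `V = N`. -/
theorem isSuperfluous_ker (h : IsDualExtension ι ε) (hη : IsInduced ε η) (hη' : IsInduced ε η')
    (hF : HasComponents ε η η' F f 0) (hf : IsSuperfluous (LinearMap.ker f)) :
    IsSuperfluous (LinearMap.ker F) := by
  intro V hV
  let W : Submodule A M :=
    { carrier := {x | ∃ y, η x + ε • η y ∈ V}
      add_mem' := by
        rintro x x' ⟨y, hy⟩ ⟨y', hy'⟩
        refine ⟨y + y', ?_⟩
        have := V.add_mem hy hy'
        rw [map_add, map_add, smul_add]
        convert this using 1
        abel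
      zero_mem' := ⟨0, by simp⟩
      smul_mem' := by
        rintro a x ⟨y, hy⟩
        refine ⟨a • y, ?_⟩
        have := V.smul_mem (ι a) hy
        rwa [smul_add, ← h.smul_comm, ← map_smulₛₗ, ← map_smulₛₗ] at this }
  have hW : W = ⊤ := by
    refine hf W (eq_top_iff.2 fun x _ => ?_)
    obtain ⟨k, hk, v, hv, hkv⟩ := Submodule.mem_sup.1
      (hV ▸ Submodule.mem_top : η x ∈ LinearMap.ker F ⊔ V)
    obtain ⟨k₀, k₁, rfl⟩ := hη.exists_eq k
    obtain ⟨v₀, v₁, rfl⟩ := hη.exists_eq v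
    rw [LinearMap.mem_ker, hF.apply_eq_zero_iff h hη'] at hk
    have hx : k₀ + v₀ = x := by
      refine (hη.eq_and_eq (y := k₁ + v₁) (y' := 0) ?_).1
      rw [map_zero, smul_zero, add_zero, ← hkv, map_add, map_add, smul_add]
      abel
    exact Submodule.mem_sup.2 ⟨k₀, hk.1, v₀, ⟨v₁, hv⟩, hx⟩
  have hmem : ∀ x, ∃ y, η x + ε • η y ∈ V := fun x => by
    have : x ∈ W := hW ▸ Submodule.mem_top
    exact this
  have hε : ∀ x, ε • η x ∈ V := fun x => by
    obtain ⟨y, hy⟩ := hmem x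
    have := V.smul_mem ε hy
    rwa [smul_add, h.smul_smul_eq_zero, add_zero] at this
  refine eq_top_iff.2 fun n _ => ?_
  obtain ⟨x, y, rfl⟩ := hη.exists_eq n
  obtain ⟨z, hz⟩ := hmem x
  exact V.add_mem ((V.add_mem_iff_left (hε z)).1 hz) (hε y)

/-- A supplement `V` of `ker f` induces the supplement `V ⊕ εV` of `ker F`. -/
theorem isSuperfluous_ker_of (h : IsDualExtension ι ε) (hη : IsInduced ε η)
    (hF : HasComponents ε η η' F f 0) (hFs : IsSuperfluous (LinearMap.ker F)) :
    IsSuperfluous (LinearMap.ker f) := by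
  intro V hV
  let W : Submodule B N :=
    { carrier := {n | ∃ x ∈ V, ∃ y ∈ V, η x + ε • η y = n}
      add_mem' := by
        rintro _ _ ⟨x, hx, y, hy, rfl⟩ ⟨x', hx', y', hy', rfl⟩
        refine ⟨x + x', V.add_mem hx hx', y + y', V.add_mem hy hy', ?_⟩
        rw [map_add, map_add, smul_add]
        abel
      zero_mem' := ⟨0, V.zero_mem, 0, V.zero_mem, by simp⟩
      smul_mem' := by
        rintro b _ ⟨x, hx, y, hy, rfl⟩
        obtain ⟨⟨a, a'⟩, rfl⟩ := h.bijective.2 b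
        exact ⟨a • x, V.smul_mem a hx, a • y + a' • x,
          V.add_mem (V.smul_mem a hy) (V.smul_mem a' hx), (h.smul_add_smul η a a' x y).symm⟩ }
  have hmem : ∀ x, η x ∈ LinearMap.ker F ⊔ W := by
    intro x
    obtain ⟨k, hk, v, hv, rfl⟩ := Submodule.mem_sup.1
      (hV ▸ Submodule.mem_top : x ∈ LinearMap.ker f ⊔ V)
    refine Submodule.mem_sup.2 ⟨η k, ?_, η v, ⟨v, hv, 0, V.zero_mem, by simp⟩, (map_add η k v).symm⟩
    rw [LinearMap.mem_ker, hF k, LinearMap.mem_ker.1 hk]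
    simp
  have hW : W = ⊤ := by
    refine hFs W (eq_top_iff.2 fun n _ => ?_)
    obtain ⟨x, y, rfl⟩ := hη.exists_eq n
    exact add_mem (hmem x) (Submodule.smul_mem _ _ (hmem y))
  refine eq_top_iff.2 fun x _ => ?_
  obtain ⟨v, hv, w, -, hvw⟩ : η x ∈ W := hW ▸ Submodule.mem_top
  have : v = x := (hη.eq_and_eq (y' := 0) (by simpa using hvw)).1
  exact this ▸ hv

theorem isMinProjPres (h : IsDualExtension ι ε) (hη : IsInduced ε η) (hη' : IsInduced ε η')
    (hη'' : IsInduced ε η'') (hF : HasComponents ε η η' F f 0)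
    (hG : HasComponents ε η' η'' G g 0) (hfg : IsMinProjPres f g) : IsMinProjPres F G where
  finite₁ := by
    have := hfg.finite₁
    exact hη.finite
  finite₀ := by
    have := hfg.finite₀
    exact hη'.finite
  projective₁ := by
    have := hfg.projective₁
    exact hη.projective h
  projective₀ := by
    have := hfg.projective₀
    exact hη'.projective h
  surjective := (hG.surjective_iff h hη' hη'').2 hfg.surjective
  exact := (hF.exact_iff h hη hη' hη'' hG).2 hfg.exact
  minimal₀ := hG.isSuperfluous_ker h hη' hη'' hfg.minimal₀
  minimal₁ := hF.isSuperfluous_ker h hη hη' hfg.minimal₁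

theorem isMinProjPres_of [Module.Finite A M] [Module.Projective A M] [Module.Finite A M']
    [Module.Projective A M'] (h : IsDualExtension ι ε) (hη : IsInduced ε η) (hη' : IsInduced ε η')
    (hη'' : IsInduced ε η'') (hF : HasComponents ε η η' F f 0)
    (hG : HasComponents ε η' η'' G g 0) (hFG : IsMinProjPres F G) : IsMinProjPres f g where
  finite₁ := inferInstance
  finite₀ := inferInstance
  projective₁ := inferInstance
  projective₀ := inferInstance
  surjective := (hG.surjective_iff h hη' hη'').1 hFG.surjective
  exact := (hF.exact_iff h hη hη' hη'' hG).1 hFG.exact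
  minimal₀ := hG.isSuperfluous_ker_of h hη' hFG.minimal₀
  minimal₁ := hF.isSuperfluous_ker_of h hη hFG.minimal₁

/-- As `F` has no `ε`-component, the equation `H = a F + F b` splits into one equation for each
component of `H`. -/
theorem isRigidMap (h : IsDualExtension ι ε) (hη : IsInduced ε η) (hη' : IsInduced ε η')
    (hF : HasComponents ε η η' F f 0) (hf : IsRigidMap f) : IsRigidMap F := by
  intro H
  obtain ⟨h₀, h₁, hH⟩ := exists_components η hη' h H
  obtain ⟨a₀, b₀, rfl⟩ := hf h₀
  obtain ⟨a₁, b₁, rfl⟩ := hf h₁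
  obtain ⟨a, ha⟩ := exists_hom h hη' η' a₀ a₁
  obtain ⟨b, hb⟩ := exists_hom h hη η b₀ b₁
  refine ⟨a, b, hH.hom_unique hη ?_⟩
  simpa using (ha.comp h hF).add (hF.comp h hb)

theorem isRigidMap_of (h : IsDualExtension ι ε) (hη : IsInduced ε η) (hη' : IsInduced ε η')
    {f₁ : M →ₗ[A] M'} (hF : HasComponents ε η η' F f f₁) (hr : IsRigidMap F) : IsRigidMap f := by
  intro k
  obtain ⟨H, hH⟩ := exists_hom h hη η' k 0
  obtain ⟨a, b, rfl⟩ := hr H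
  obtain ⟨a₀, a₁, ha⟩ := exists_components η' hη' h a
  obtain ⟨b₀, b₁, hb⟩ := exists_components η hη h b
  exact ⟨a₀, b₀, (hH.unique hη' ((ha.comp h hF).add (hF.comp h hb))).1⟩

/-- `1 + ε a` is invertible. -/
theorem exists_equiv_one_add (h : IsDualExtension ι ε) (hη : IsInduced ε η) (a : M →ₗ[A] M) :
    ∃ α : N ≃ₗ[B] N, HasComponents ε η η α.toLinearMap LinearMap.id a := by
  obtain ⟨α, hα⟩ := exists_hom h hη η LinearMap.id a
  obtain ⟨α', hα'⟩ := exists_hom h hη η LinearMap.id (-a)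
  refine ⟨LinearEquiv.ofLinearMap α α' ?_ ?_, hα⟩
  · refine (hα.comp h hα').hom_unique hη ?_
    simpa using HasComponents.id (ε := ε) η
  · refine (hα'.comp h hα).hom_unique hη ?_
    simpa using HasComponents.id (ε := ε) η

/-- A first order deformation of a rigid map is trivial. -/
theorem exists_trivialization (h : IsDualExtension ι ε) (hη : IsInduced ε η)
    (hη' : IsInduced ε η') {f₁ : M →ₗ[A] M'} (hF : HasComponents ε η η' F f f₁)
    (hf : IsRigidMap f) : ∃ (F₀ : N →ₗ[B] N') (α : N' ≃ₗ[B] N') (β : N ≃ₗ[B] N),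
      HasComponents ε η η' F₀ f 0 ∧ F = α.toLinearMap ∘ₗ F₀ ∘ₗ β.toLinearMap := by
  -- With `f₁ = a f + f b` and `ε² = 0`, one has `f + ε f₁ = (1 + εa) f (1 + εb)`.
  obtain ⟨a, b, rfl⟩ := hf f₁
  obtain ⟨F₀, hF₀⟩ := exists_hom h hη η' f 0
  obtain ⟨α, hα⟩ := exists_equiv_one_add h hη' a
  obtain ⟨β, hβ⟩ := exists_equiv_one_add h hη b
  refine ⟨F₀, α, β, hF₀, hF.hom_unique hη ?_⟩
  simpa using hα.comp h (hF₀.comp h hβ)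

/-- The cokernel of an induced map is induced. -/
theorem exists_isInduced_coker (h : IsDualExtension ι ε) (hη : IsInduced ε η)
    (hη' : IsInduced ε η') (hF : HasComponents ε η η' F f 0) {G : N' →ₗ[B] N''}
    (hG : Function.Surjective G) (hFG : Function.Exact F G) :
    ∃ θ : (M' ⧸ LinearMap.range f) →ₛₗ[ι] N'', IsInduced ε θ ∧
      HasComponents ε η' θ G (LinearMap.range f).mkQ 0 := by
  let g : M' →ₛₗ[ι] N'' := ⟨⟨fun x => G (η' x), fun x y => by simp⟩, fun a x => by simp⟩
  have hg : LinearMap.range f ≤ LinearMap.ker g := by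
    rintro _ ⟨x, rfl⟩
    have := hF x
    rw [LinearMap.zero_apply, map_zero, smul_zero, add_zero] at this
    change G (η' (f x)) = 0
    rw [← this]
    exact (hFG _).2 ⟨_, rfl⟩
  refine ⟨(LinearMap.range f).liftQ g hg, isInduced_iff.2 ⟨?_, ?_⟩, fun x => ?_⟩
  · intro x y hxy
    obtain ⟨x, rfl⟩ := Submodule.mkQ_surjective _ x
    obtain ⟨y, rfl⟩ := Submodule.mkQ_surjective _ y
    have hG0 : G (η' x + ε • η' y) = 0 := by
      rw [map_add, map_smul]
      exact hxy
    obtain ⟨hx, hy⟩ := (hF.mem_range_iff h hη hη' x y).1 ((hFG _).1 hG0)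
    exact ⟨(Submodule.Quotient.mk_eq_zero _).2 hx, (Submodule.Quotient.mk_eq_zero _).2 hy⟩
  · intro n
    obtain ⟨n, rfl⟩ := hG n
    obtain ⟨x, y, rfl⟩ := hη'.exists_eq n
    refine ⟨Submodule.Quotient.mk x, Submodule.Quotient.mk y, ?_⟩
    rw [map_add, map_smul]
    rfl
  · rw [LinearMap.zero_apply, map_zero, smul_zero, add_zero]
    rfl

end HasComponents

theorem IsSuperfluous.comap_equiv {A : Type u} [Ring A] {M M' : Type u} [AddCommGroup M]
    [Module A M] [AddCommGroup M'] [Module A M'] {U : Submodule A M'} (hU : IsSuperfluous U)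
    (e : M ≃ₗ[A] M') : IsSuperfluous (U.comap e.toLinearMap) := by
  intro V hV
  have h1 : U ⊔ V.map e.toLinearMap = ⊤ := by
    rw [← Submodule.map_comap_eq_of_surjective (f := e.toLinearMap) e.surjective U,
      ← Submodule.map_sup, hV, Submodule.map_top, LinearMap.range_eq_top]
    exact e.surjective
  have h2 := hU _ h1
  refine eq_top_iff.2 fun x _ => ?_
  obtain ⟨y, hy, hxy⟩ : e x ∈ V.map e.toLinearMap := h2 ▸ Submodule.mem_top
  exact e.injective hxy ▸ hy

/-- Strips the automorphisms of a trivialization from the first map: `α` is absorbed into `π`, and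
`β` does not affect the image. -/
theorem IsMinProjPres.of_comp_equiv {A : Type u} [Ring A] {P₁ P₀ M : Type u} [AddCommGroup P₁]
    [Module A P₁] [AddCommGroup P₀] [Module A P₀] [AddCommGroup M] [Module A M]
    {d : P₁ →ₗ[A] P₀} {π : P₀ →ₗ[A] M} {α : P₀ ≃ₗ[A] P₀} {β : P₁ ≃ₗ[A] P₁}
    (h : IsMinProjPres (α.toLinearMap ∘ₗ d ∘ₗ β.toLinearMap) π) :
    IsMinProjPres d (π ∘ₗ α.toLinearMap) where
  finite₁ := h.finite₁
  finite₀ := h.finite₀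
  projective₁ := h.projective₁
  projective₀ := h.projective₀
  surjective := h.surjective.comp α.surjective
  exact := by
    intro x
    refine (h.exact (α x)).trans ⟨?_, ?_⟩
    · rintro ⟨y, hy⟩
      exact ⟨β y, α.injective hy⟩
    · rintro ⟨y, rfl⟩
      exact ⟨β.symm y, by simp⟩
  minimal₀ := by
    rw [LinearMap.ker_comp]
    exact h.minimal₀.comap_equiv α
  minimal₁ := by
    have := h.minimal₁.comap_equiv β.symm
    convert this using 1
    ext x
    simp

end InducedPresentation

/-! ### The induction functor of a dual number extension -/

section InductionFunctor

variable {A B : Type u} [Ring A] [Ring B] {ι : A →+* B} {ε : B}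

theorem isoClass_eq_iff {A : Type u} [Ring A] {X Y : ModuleCat.{u} A} :
    (⟦X⟧ : IsoClass A) = ⟦Y⟧ ↔ Nonempty (X ≃ₗ[A] Y) := by
  rw [Quotient.eq]
  constructor
  · rintro ⟨e⟩
    exact ⟨e.toLinearEquiv⟩
  · rintro ⟨e⟩
    exact ⟨e.toModuleIso⟩

/-- A functor with a (not necessarily natural) identification of its values as induced modules. -/
structure InductionData (ι : A →+* B) (ε : B) where
  /-- the functor -/
  functor : CategoryTheory.Functor (ModuleCat.{u} A) (ModuleCat.{u} B)
  /-- the map `M → M ⊕ ε M` -/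
  unit : ∀ M : ModuleCat.{u} A, M →ₛₗ[ι] functor.obj M
  isDualExtension : IsDualExtension ι ε
  isInduced : ∀ M, IsInduced ε (unit M)

/-! ### Indecomposable summands and basic modules under induction -/

namespace InductionData

variable {M N : Type u} [AddCommGroup M] [Module A M] [AddCommGroup N] [Module B N]
  {η : M →ₛₗ[ι] N}

/-- For the forward direction the functor supplies modules induced from the factors of a
decomposition of `M`; their product is isomorphic to `N`. -/
theorem isIndecomposable_iff (I : InductionData ι ε) (hη : IsInduced ε η) :
    IsIndecomposable B N ↔ IsIndecomposable A M := by
  have h := I.isDualExtension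
  refine ⟨fun H => ?_, hη.isIndecomposable_of h⟩
  rw [TauTilting.isIndecomposable_iff] at H ⊢
  refine ⟨hη.nontrivial_iff.1 H.1, fun Y Z e => ?_⟩
  obtain ⟨e'⟩ := hη.nonempty_equiv_of_equiv h ((I.isInduced Y).prod (I.isInduced Z)) e
  rw [← (I.isInduced Y).nontrivial_iff, ← (I.isInduced Z).nontrivial_iff]
  exact H.2 _ _ e'

theorem mapIsoClass_eq (I : InductionData ι ε) {X : ModuleCat.{u} A} {Y : ModuleCat.{u} B} {θ : X →ₛₗ[ι] Y}
    (hθ : IsInduced ε θ) : mapIsoClass I.functor ⟦X⟧ = ⟦Y⟧ :=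
  isoClass_eq_iff.2
    ((I.isInduced X).nonempty_equiv_of_equiv I.isDualExtension hθ (LinearEquiv.refl A X))

theorem mapIsoClass_injective (I : InductionData ι ε) : Function.Injective (mapIsoClass I.functor) := by
  intro c c' h
  induction c using Quotient.inductionOn with | h X
  induction c' using Quotient.inductionOn with | h Y
  obtain ⟨e⟩ := isoClass_eq_iff.1 h
  exact isoClass_eq_iff.2 ((I.isInduced X).nonempty_equiv I.isDualExtension (I.isInduced Y) e)

/-- Induction is injective on isomorphism classes, and it maps the indecomposable summands of `M`
onto those of `N` because summands of `N` are induced. -/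
theorem numIndec_eq (I : InductionData ι ε) (hη : IsInduced ε η) : numIndec B N = numIndec A M := by
  have h := I.isDualExtension
  unfold numIndec
  rw [← I.mapIsoClass_injective.injOn.encard_image]
  congr 1
  ext c
  constructor
  · rintro ⟨Y, hY, hYN, rfl⟩
    obtain ⟨X, θ, hX, hθ⟩ := hη.exists_of_isSummand h hYN
    exact ⟨⟦X⟧, ⟨X, (I.isIndecomposable_iff hθ).1 hY, hX, rfl⟩, I.mapIsoClass_eq hθ⟩
  · rintro ⟨_, ⟨X, hX, hXM, rfl⟩, rfl⟩
    exact ⟨I.functor.obj X, (I.isIndecomposable_iff (I.isInduced X)).2 hX,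
      ((I.isInduced X).isSummand_iff h hη).2 hXM, rfl⟩

theorem isBasic_iff (I : InductionData ι ε) (hη : IsInduced ε η) : IsBasic B N ↔ IsBasic A M := by
  have h := I.isDualExtension
  constructor
  · intro H X hX hXM
    exact H (I.functor.obj X) ((I.isIndecomposable_iff (I.isInduced X)).2 hX)
      ((((I.isInduced X).prod (I.isInduced X)).isSummand_iff h hη).2 hXM)
  · intro H Y hY hYN
    have hYY : IsSummand B Y (Y × Y) :=
      ⟨LinearMap.inl B Y Y, LinearMap.fst B Y Y, LinearMap.fst_comp_inl B Y Y⟩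
    obtain ⟨i, r, hir⟩ := hYN
    obtain ⟨i', r', hir'⟩ := hYY
    obtain ⟨X, θ, -, hθ⟩ := hη.exists_of_isSummand h (Y := Y) ⟨i ∘ₗ i', r' ∘ₗ r, by
      rw [LinearMap.comp_assoc, ← LinearMap.comp_assoc i' i r, hir, LinearMap.id_comp, hir']⟩
    exact H X ((I.isIndecomposable_iff hθ).1 hY)
      (((hθ.prod hθ).isSummand_iff h hη).1 ⟨i, r, hir⟩)

theorem exists_isMinProjPres (I : InductionData ι ε) {P₁ P₀ : ModuleCat.{u} A}
    {d : P₁ →ₗ[A] P₀} {π : P₀ →ₗ[A] M} (hη : IsInduced ε η) (h : IsMinProjPres d π) :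
    ∃ (D : I.functor.obj P₁ →ₗ[B] I.functor.obj P₀) (ρ : I.functor.obj P₀ →ₗ[B] N),
      HasComponents ε (I.unit P₁) (I.unit P₀) D d 0 ∧ IsMinProjPres D ρ := by
  obtain ⟨D, hD⟩ := HasComponents.exists_hom I.isDualExtension (I.isInduced P₁) (I.unit P₀) d 0
  obtain ⟨ρ, hρ⟩ := HasComponents.exists_hom I.isDualExtension (I.isInduced P₀) η π 0
  exact ⟨D, ρ, hD, hD.isMinProjPres I.isDualExtension (I.isInduced P₁) (I.isInduced P₀) hη hρ h⟩

/-! ### Transfer of `τ`-rigid and support `τ`-tilting modules -/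

section SupportTauTilting

variable (K : Type u) [Field K] [Algebra K A] [Algebra K B]

theorem isTauRigid (I : InductionData ι ε) (hη : IsInduced ε η) (hM : IsTauRigid K A M) : IsTauRigid K B N := by
  obtain ⟨hfin, P₁, P₀, d, π, hd, hH⟩ := hM
  obtain ⟨D, ρ, hD, hDρ⟩ := I.exists_isMinProjPres hη hd
  refine ⟨hη.finite, _, _, D, ρ, hDρ, ?_⟩
  rw [hDρ.hom_arTranslate_eq_zero_iff K]
  rw [hd.hom_arTranslate_eq_zero_iff K] at hH
  exact hD.isRigidMap I.isDualExtension (I.isInduced P₁) (I.isInduced P₀) hH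

/-- Every `τ`-rigid `B`-module is induced from a `τ`-rigid `A`-module. -/
theorem exists_of_isTauRigid (h : IsDualExtension ι ε) (hN : IsTauRigid K B N) :
    ∃ (M : ModuleCat.{u} A) (η : M →ₛₗ[ι] N), IsTauRigid K A M ∧ IsInduced ε η := by
  obtain ⟨-, P₁, P₀, D, ρ, hD, hH⟩ := hN
  rw [hD.hom_arTranslate_eq_zero_iff K] at hH
  have := hD.finite₀
  have := hD.finite₁
  have := hD.projective₀
  have := hD.projective₁
  obtain ⟨Q₁, θ₁, _, _, hθ₁⟩ := h.exists_of_projective P₁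
  obtain ⟨Q₀, θ₀, _, _, hθ₀⟩ := h.exists_of_projective P₀
  obtain ⟨d₀, d₁, hd⟩ := HasComponents.exists_components θ₁ hθ₀ h D
  -- `D = d₀ + ε d₁` is a deformation of the rigid map `d₀`, hence trivial. Up to automorphisms of
  -- its terms it is induced from `d₀`, and its cokernel is induced from `coker d₀`.
  have hd₀ := hd.isRigidMap_of h hθ₁ hθ₀ hH
  obtain ⟨D₀, α, β, hD₀, rfl⟩ := hd.exists_trivialization h hθ₁ hθ₀ hd₀
  have hpres := hD.of_comp_equiv
  obtain ⟨η, hη, hρ⟩ := hD₀.exists_isInduced_coker h hθ₁ hθ₀ hpres.surjective hpres.exact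
  have hmin := hD₀.isMinProjPres_of h hθ₁ hθ₀ hη hρ hpres
  refine ⟨ModuleCat.of A (Q₀ ⧸ LinearMap.range d₀), η, ⟨?_, Q₁, Q₀, d₀, _, hmin, ?_⟩, hη⟩
  · exact inferInstanceAs (Module.Finite A (Q₀ ⧸ LinearMap.range d₀))
  · exact (hmin.hom_arTranslate_eq_zero_iff K).2 hd₀

theorem isSupportTauTilting (I : InductionData ι ε) (hη : IsInduced ε η) (hM : IsSupportTauTilting K A M) :
    IsSupportTauTilting K B N := by
  have h := I.isDualExtension
  obtain ⟨P, hr, _, _, hhom, hnum⟩ := hM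
  refine ⟨I.functor.obj P, I.isTauRigid K hη hr, (I.isInduced P).finite,
    (I.isInduced P).projective h, fun f => ?_, ?_⟩
  -- Both components of a map between the induced modules are maps `P → M`, hence zero.
  · obtain ⟨f₀, f₁, hf⟩ := HasComponents.exists_components (I.unit P) hη h f
    rw [hhom f₀, hhom f₁] at hf
    exact hf.hom_unique (I.isInduced P) (HasComponents.zero _ _)
  · rw [I.numIndec_eq (hη.prod (I.isInduced P)), hnum, I.numIndec_eq (isInduced_ringHom h)]

theorem exists_of_isSupportTauTilting (I : InductionData ι ε) (hN : IsSupportTauTilting K B N) :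
    ∃ (M : ModuleCat.{u} A) (η : M →ₛₗ[ι] N), IsSupportTauTilting K A M ∧ IsInduced ε η := by
  have h := I.isDualExtension
  obtain ⟨P, hr, _, _, hhom, hnum⟩ := hN
  obtain ⟨M, η, hM, hη⟩ := exists_of_isTauRigid K h hr
  obtain ⟨Q, θ, hQf, hQp, hθ⟩ := h.exists_of_projective P
  refine ⟨M, η, ⟨Q, hM, hQf, hQp, fun f => ?_, ?_⟩, hη⟩
  · obtain ⟨F, hF⟩ := HasComponents.exists_hom h hθ η f 0
    rw [hhom F] at hF
    exact (hF.unique hη (HasComponents.zero _ _)).1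
  · rw [← I.numIndec_eq (hη.prod hθ), hnum, I.numIndec_eq (isInduced_ringHom h)]

theorem bijOn_supportTauTiltingClasses (I : InductionData ι ε) : Set.BijOn (mapIsoClass I.functor)
    (supportTauTiltingClasses K A) (supportTauTiltingClasses K B) := by
  refine ⟨?_, I.mapIsoClass_injective.injOn, ?_⟩
  · rintro _ ⟨M, hM, rfl⟩
    exact ⟨I.functor.obj M, I.isSupportTauTilting K (I.isInduced M) hM, rfl⟩
  · rintro _ ⟨N, hN, rfl⟩
    obtain ⟨M, η, hM, hη⟩ := I.exists_of_isSupportTauTilting K hN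
    exact ⟨⟦M⟧, ⟨M, hM, rfl⟩, I.mapIsoClass_eq hη⟩

theorem bijOn_basicSupportTauTiltingClasses (I : InductionData ι ε) : Set.BijOn (mapIsoClass I.functor)
    (basicSupportTauTiltingClasses K A) (basicSupportTauTiltingClasses K B) := by
  refine ⟨?_, I.mapIsoClass_injective.injOn, ?_⟩
  · rintro _ ⟨M, hM, hb, rfl⟩
    exact ⟨I.functor.obj M, I.isSupportTauTilting K (I.isInduced M) hM,
      (I.isBasic_iff (I.isInduced M)).2 hb, rfl⟩
  · rintro _ ⟨N, hN, hb, rfl⟩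
    obtain ⟨M, η, hM, hη⟩ := I.exists_of_isSupportTauTilting K hN
    exact ⟨⟦M⟧, ⟨M, hM, (I.isBasic_iff hη).1 hb, rfl⟩, I.mapIsoClass_eq hη⟩

end SupportTauTilting

/-! ### Indecomposable projectives and `g`-vectors -/

section GVector

variable {n : ℕ} {P : Fin n → ModuleCat.{u} A}

theorem isProjIndecList (I : InductionData ι ε) (hP : IsProjIndecList P) :
    IsProjIndecList (fun i => I.functor.obj (P i)) := by
  have h := I.isDualExtension
  refine ⟨fun i => ?_, fun i => ?_, fun i => ?_, fun i j => ?_, fun Q _ _ hQ => ?_⟩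
  · have := hP.finite i
    exact (I.isInduced (P i)).finite
  · have := hP.projective i
    exact (I.isInduced (P i)).projective h
  · exact (I.isIndecomposable_iff (I.isInduced (P i))).2 (hP.indecomposable i)
  · rintro ⟨e⟩
    exact hP.injective i j ((I.isInduced (P i)).nonempty_equiv h (I.isInduced (P j)) e)
  · obtain ⟨X, θ, hXf, hXp, hθ⟩ := h.exists_of_projective Q
    obtain ⟨i, ⟨e⟩⟩ := hP.complete X hXf hXp ((I.isIndecomposable_iff hθ).1 hQ)
    exact ⟨i, hθ.nonempty_equiv_of_equiv h (I.isInduced (P i)) e⟩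

theorem isInduced_pow (I : InductionData ι ε) (P : Fin n → ModuleCat.{u} A) (a : Fin n → ℕ) :
    IsInduced ε (piSemilinear fun i : Fin n => piSemilinear fun _ : Fin (a i) => I.unit (P i)) :=
  IsInduced.pi fun _ => IsInduced.pi fun _ => I.isInduced _

theorem exists_gVector (I : InductionData ι ε) (K : Type u) [Field K] [Algebra K A] [Module.Finite K A]
    (hP : IsProjIndecList P) (M : ModuleCat.{u} A) (hM : Module.Finite A M) :
    ∃ g : Fin n → ℤ, (∀ g' : Fin n → ℤ, IsGVector P M g' ↔ g' = g) ∧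
      (∀ g' : Fin n → ℤ, IsGVector (fun i => I.functor.obj (P i)) (I.functor.obj M) g' ↔
        g' = g) := by
  have h := I.isDualExtension
  have : IsArtinianRing A := IsArtinianRing.of_finite K A
  have : IsNoetherianRing A := IsNoetherianRing.of_finite K A
  obtain ⟨P₁, P₀, d, π, hd⟩ := TauTilting.exists_isMinProjPres (A := A) M
  have := hd.finite₀
  have := hd.finite₁
  have := hd.projective₀
  have := hd.projective₁
  obtain ⟨a, ⟨ea⟩⟩ := hP.exists_equiv P₀
  obtain ⟨b, ⟨eb⟩⟩ := hP.exists_equiv P₁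
  refine ⟨fun i => (a i : ℤ) - (b i : ℤ), fun g' => ⟨?_, ?_⟩, fun g' => ⟨?_, ?_⟩⟩
  · rintro ⟨Q₁, Q₀, d', π', hd', a', b', ⟨ea'⟩, ⟨eb'⟩, hg⟩
    obtain ⟨⟨e₀⟩, ⟨e₁⟩⟩ := hd.nonempty_equiv hd'
    have ha := hP.multiplicity_unique K ((ea.symm.trans e₀).trans ea')
    have hb := hP.multiplicity_unique K ((eb.symm.trans e₁).trans eb')
    subst ha hb
    exact funext hg
  · rintro rfl
    exact ⟨P₁, P₀, d, π, hd, a, b, ⟨ea⟩, ⟨eb⟩, fun _ => rfl⟩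
  -- The given presentation is isomorphic to the induced one, and its decompositions reduce modulo
  -- `ε` to decompositions of `P₀` and `P₁`. Uniqueness of multiplicities is thus needed over `A`
  -- only.
  · rintro ⟨Q₁, Q₀, d', π', hd', a', b', ⟨ea'⟩, ⟨eb'⟩, hg⟩
    obtain ⟨D, ρ, -, hD⟩ := I.exists_isMinProjPres (I.isInduced M) hd
    obtain ⟨⟨e₀⟩, ⟨e₁⟩⟩ := hD.nonempty_equiv hd'
    obtain ⟨f₀⟩ := (I.isInduced P₀).nonempty_equiv h (I.isInduced_pow P a') (e₀.trans ea')
    obtain ⟨f₁⟩ := (I.isInduced P₁).nonempty_equiv h (I.isInduced_pow P b') (e₁.trans eb')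
    have ha := hP.multiplicity_unique K (ea.symm.trans f₀)
    have hb := hP.multiplicity_unique K (eb.symm.trans f₁)
    subst ha hb
    exact funext hg
  · rintro rfl
    obtain ⟨D, ρ, -, hD⟩ := I.exists_isMinProjPres (I.isInduced M) hd
    exact ⟨_, _, D, ρ, hD, a, b,
      (I.isInduced P₀).nonempty_equiv_of_equiv h (I.isInduced_pow P a) ea,
      (I.isInduced P₁).nonempty_equiv_of_equiv h (I.isInduced_pow P b) eb, fun _ => rfl⟩

end GVector

end InductionData

end InductionFunctor

/-! ### Induction along an extension with basis `1, e` -/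

section DualBasis

variable {R B : Type u} [Ring R] [Ring B]

/-- `B` is free over `R` with basis `1, e`, where `e` is central with `e² = 0`, and `c₀`, `c₁` are
the coordinate functions. -/
structure IsDualBasis (φ : R →+* B) (e : B) (c₀ c₁ : B →+ R) : Prop where
  comm : ∀ b, e * b = b * e
  sq : e * e = 0
  fst_mul : ∀ r b, c₀ (φ r * b) = r * c₀ b
  snd_mul : ∀ r b, c₁ (φ r * b) = r * c₁ b
  fst_one : c₀ 1 = 1
  snd_one : c₁ 1 = 0
  fst_eps : c₀ e = 0
  snd_eps : c₁ e = 1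
  eq_add : ∀ b, φ (c₀ b) * 1 + φ (c₁ b) * e = b

/-- A ring homomorphism, on opposite rings. -/
def opHom (φ : R →+* B) :
    @RingHom Rᵐᵒᵖ Bᵐᵒᵖ Semiring.toNonAssocSemiring Semiring.toNonAssocSemiring :=
  RingHom.op φ

theorem opHom_apply (φ : R →+* B) (r : Rᵐᵒᵖ) : opHom φ r = MulOpposite.op (φ r.unop) := rfl

variable {φ : R →+* B} {e : B} {c₀ c₁ : B →+ R}

theorem IsDualBasis.isDualExtension (h : IsDualBasis φ e c₀ c₁) :
    IsDualExtension (opHom φ) (MulOpposite.op e) where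
  comm b := MulOpposite.unop_injective (h.comm b.unop).symm
  sq := by rw [← MulOpposite.op_mul, h.sq, MulOpposite.op_zero]
  bijective := by
    have key : ∀ a : Rᵐᵒᵖ × Rᵐᵒᵖ, opHom φ a.1 + MulOpposite.op e * opHom φ a.2
        = MulOpposite.op (φ a.1.unop * 1 + φ a.2.unop * e) := by
      intro a
      rw [opHom_apply, opHom_apply, ← MulOpposite.op_mul, ← MulOpposite.op_add, mul_one]
    constructor
    · intro a a' haa
      simp only [key] at haa
      have h' := MulOpposite.op_injective haa
      have h0 := congrArg c₀ h'
      have h1 := congrArg c₁ h'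
      simp only [map_add, h.fst_mul, h.snd_mul] at h0 h1
      simp only [h.fst_one, h.snd_one, h.fst_eps, h.snd_eps, mul_one, mul_zero, add_zero,
        zero_add] at h0 h1
      exact Prod.ext (MulOpposite.unop_injective h0) (MulOpposite.unop_injective h1)
    · intro b
      exact ⟨(MulOpposite.op (c₀ b.unop), MulOpposite.op (c₁ b.unop)),
        (key _).trans (MulOpposite.unop_injective (h.eq_add b.unop))⟩

variable (φ) (c₀ c₁) (M : Type u) [AddCommGroup M] [Module Rᵐᵒᵖ M]

theorem mk_balancedRel (r : R) (b : B) (m : M) :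
    (Submodule.Quotient.mk ((φ r * b) ⊗ₜ m) : Ind φ M)
      = Submodule.Quotient.mk (b ⊗ₜ (MulOpposite.op r • m)) :=
  (Submodule.Quotient.eq _).2 (Submodule.subset_span ⟨r, b, m, rfl⟩)

theorem op_smul_mk (b b' : B) (m : M) :
    MulOpposite.op b' • (Submodule.Quotient.mk (b ⊗ₜ m) : Ind φ M)
      = Submodule.Quotient.mk ((b * b') ⊗ₜ m) := rfl

/-- The map `M → M ⊗_R B`, `m ↦ m ⊗ 1`. -/
def indUnit : LinearMap (opHom φ) M (Ind φ M) where
  toFun m := Submodule.Quotient.mk (1 ⊗ₜ m)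
  map_add' m m' := by
    rw [TensorProduct.tmul_add]
    rfl
  map_smul' a m := by
    rw [opHom_apply, op_smul_mk, one_mul, ← mul_one (φ a.unop), mk_balancedRel, MulOpposite.op_unop]

/-- The coordinates of an element of `B ⊗_ℤ M`. -/
def indCoord : (B ⊗[ℤ] M) →+ M × M :=
  TensorProduct.liftAddHom
    (AddMonoidHom.mk' (fun b => AddMonoidHom.mk' (fun m =>
      (MulOpposite.op (c₀ b) • m, MulOpposite.op (c₁ b) • m))
      fun m m' => by simp) fun b b' => by
        ext m <;> simp [add_smul])
    fun r b m => by
      change (MulOpposite.op (c₀ (r • b)) • m, MulOpposite.op (c₁ (r • b)) • m)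
        = (MulOpposite.op (c₀ b) • r • m, MulOpposite.op (c₁ b) • r • m)
      rw [map_zsmul, map_zsmul, MulOpposite.op_smul, MulOpposite.op_smul, smul_assoc, smul_assoc,
        smul_comm r, smul_comm r]

theorem indCoord_tmul (b : B) (m : M) : indCoord c₀ c₁ M (b ⊗ₜ m)
    = (MulOpposite.op (c₀ b) • m, MulOpposite.op (c₁ b) • m) := rfl

variable {φ c₀ c₁ M}

theorem IsDualBasis.indCoord_eq_zero (h : IsDualBasis φ e c₀ c₁) {z : B ⊗[ℤ] M}
    (hz : z ∈ balancedRel φ M) : indCoord c₀ c₁ M z = 0 := by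
  -- The relations are spanned over `Bᵐᵒᵖ` while `indCoord` is only additive, so the claim is
  -- strengthened to all multiples of `z`.
  suffices H : ∀ b : Bᵐᵒᵖ, indCoord c₀ c₁ M (b • z) = 0 by
    simpa using H 1
  induction hz using Submodule.span_induction with
  | mem z hz =>
    obtain ⟨r, b, m, rfl⟩ := hz
    intro b'
    rw [smul_sub, map_sub, TensorProduct.smul_tmul', TensorProduct.smul_tmul', indCoord_tmul,
      indCoord_tmul, MulOpposite.smul_eq_mul_unop, MulOpposite.smul_eq_mul_unop, mul_assoc,
      h.fst_mul, h.snd_mul, MulOpposite.op_mul, MulOpposite.op_mul, mul_smul, mul_smul, sub_self]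
  | zero => intro b; simp
  | add x y _ _ hx hy => intro b; rw [smul_add, map_add, hx, hy, add_zero]
  | smul a x _ hx => intro b; rw [← mul_smul, hx]

/-- The coordinates descend to `M ⊗_R B` and show uniqueness. For existence, expand `b` in the basis
`1, e` and move the coefficients across the tensor sign to `m`. -/
theorem IsDualBasis.isInduced (h : IsDualBasis φ e c₀ c₁) (M : Type u) [AddCommGroup M]
    [Module Rᵐᵒᵖ M] : IsInduced (MulOpposite.op e) (indUnit φ M) := by
  have key : ∀ x y : M, indUnit φ M x + MulOpposite.op e • indUnit φ M y
      = Submodule.Quotient.mk (1 ⊗ₜ x + e ⊗ₜ y) := by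
    intro x y
    rw [Submodule.Quotient.mk_add]
    congr 1
    exact (op_smul_mk φ M 1 e y).trans (by rw [one_mul])
  refine isInduced_iff.2 ⟨fun x y hxy => ?_, fun n => ?_⟩
  · rw [key, Submodule.Quotient.mk_eq_zero] at hxy
    have h' := h.indCoord_eq_zero hxy
    rw [map_add, indCoord_tmul, indCoord_tmul, h.fst_one, h.snd_one, h.fst_eps, h.snd_eps] at h'
    simpa using h'
  · obtain ⟨z, rfl⟩ := Submodule.Quotient.mk_surjective _ n
    induction z with
    | zero => exact ⟨0, 0, by simp⟩
    | tmul b m =>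
      refine ⟨MulOpposite.op (c₀ b) • m, MulOpposite.op (c₁ b) • m, ?_⟩
      rw [key, Submodule.Quotient.mk_add, ← mk_balancedRel, ← mk_balancedRel,
        ← Submodule.Quotient.mk_add, ← TensorProduct.add_tmul, h.eq_add]
    | add z w hz hw =>
      obtain ⟨x, y, hxy⟩ := hz
      obtain ⟨x', y', hxy'⟩ := hw
      refine ⟨x + x', y + y', ?_⟩
      rw [map_add, map_add, smul_add, Submodule.Quotient.mk_add, ← hxy, ← hxy']
      abel

/-- The functor `- ⊗_R B` with the maps `m ↦ m ⊗ 1`. -/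
def IsDualBasis.inductionData (h : IsDualBasis φ e c₀ c₁) :
    InductionData (opHom φ) (MulOpposite.op e) where
  functor := induction φ
  unit M := indUnit φ M
  isDualExtension := h.isDualExtension
  isInduced M := h.isInduced M

end DualBasis

/-! ### The extension `Λ → Λ̃` -/

section Tilde

variable (K Λ : Type u) [Field K] [Ring Λ] [Algebra K Λ]

/-- The coefficient of `1`. -/
def tildeFst : Tilde K Λ →ₗ[K] Λ :=
  (TensorProduct.rid K Λ).toLinearMap ∘ₗ
    LinearMap.lTensor Λ (TrivSqZeroExt.fstHom K K K).toLinearMap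

/-- The coefficient of `ε`. -/
def tildeSnd : Tilde K Λ →ₗ[K] Λ :=
  (TensorProduct.rid K Λ).toLinearMap ∘ₗ LinearMap.lTensor Λ (TrivSqZeroExt.sndHom K K)

variable {K Λ}

theorem tildeFst_tmul (l : Λ) (z : DualNumber K) :
    tildeFst K Λ (l ⊗ₜ z) = TrivSqZeroExt.fst z • l := rfl

theorem tildeSnd_tmul (l : Λ) (z : DualNumber K) :
    tildeSnd K Λ (l ⊗ₜ z) = TrivSqZeroExt.snd z • l := rfl

theorem tilde_eq (b : Tilde K Λ) :
    tildeFst K Λ b ⊗ₜ 1 + tildeSnd K Λ b ⊗ₜ DualNumber.eps = b := by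
  induction b using TensorProduct.induction_on with
  | zero => simp
  | tmul l z =>
    rw [tildeFst_tmul, tildeSnd_tmul, TensorProduct.smul_tmul, TensorProduct.smul_tmul,
      ← TensorProduct.tmul_add]
    congr 1
    ext <;> simp
  | add x y hx hy =>
    conv_rhs => rw [← hx, ← hy]
    rw [map_add, map_add, TensorProduct.add_tmul, TensorProduct.add_tmul]
    abel

variable (K Λ)

theorem isDualBasis_tilde : IsDualBasis
    (Algebra.TensorProduct.includeLeftRingHom : Λ →+* Tilde K Λ) (1 ⊗ₜ[K] DualNumber.eps)
    (tildeFst K Λ).toAddMonoidHom (tildeSnd K Λ).toAddMonoidHom where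
  comm b := by
    induction b using TensorProduct.induction_on with
    | zero => simp
    | tmul l z => simp [mul_comm]
    | add x y hx hy => rw [mul_add, add_mul, hx, hy]
  sq := by simp
  fst_mul r b := by
    change tildeFst K Λ (r ⊗ₜ 1 * b) = r * tildeFst K Λ b
    induction b using TensorProduct.induction_on with
    | zero => simp
    | tmul l z => simp [tildeFst_tmul]
    | add x y hx hy => rw [mul_add, map_add, hx, hy, map_add, mul_add]
  snd_mul r b := by
    change tildeSnd K Λ (r ⊗ₜ 1 * b) = r * tildeSnd K Λ b
    induction b using TensorProduct.induction_on with
    | zero => simp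
    | tmul l z => simp [tildeSnd_tmul]
    | add x y hx hy => rw [mul_add, map_add, hx, hy, map_add, mul_add]
  fst_one := by
    change tildeFst K Λ (1 ⊗ₜ 1) = 1
    simp [tildeFst_tmul]
  snd_one := by
    change tildeSnd K Λ (1 ⊗ₜ 1) = 0
    simp [tildeSnd_tmul]
  fst_eps := by
    change tildeFst K Λ (1 ⊗ₜ DualNumber.eps) = 0
    simp [tildeFst_tmul]
  snd_eps := by
    change tildeSnd K Λ (1 ⊗ₜ DualNumber.eps) = 1
    simp [tildeSnd_tmul]
  eq_add b := by
    change (tildeFst K Λ b ⊗ₜ 1) * 1 + (tildeSnd K Λ b ⊗ₜ 1) * (1 ⊗ₜ DualNumber.eps) = b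
    rw [mul_one, Algebra.TensorProduct.tmul_mul_tmul, mul_one, one_mul, tilde_eq]

end Tilde

end TauTilting

open TauTilting in
theorem mainTheorem4 (K Λ : Type u) [Field K] [IsAlgClosed K] [Ring Λ] [Algebra K Λ]
    [Module.Finite K Λ] :
    Set.BijOn (mapIsoClass (tildeInduction K Λ))
      (supportTauTiltingClasses K Λᵐᵒᵖ) (supportTauTiltingClasses K (Tilde K Λ)ᵐᵒᵖ) ∧
    Set.BijOn (mapIsoClass (tildeInduction K Λ))
      (basicSupportTauTiltingClasses K Λᵐᵒᵖ) (basicSupportTauTiltingClasses K (Tilde K Λ)ᵐᵒᵖ) ∧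
    ∀ (n : ℕ) (P : Fin n → ModuleCat.{u} Λᵐᵒᵖ), IsProjIndecList P →
      IsProjIndecList (fun i => (tildeInduction K Λ).obj (P i)) ∧
      ∀ M : ModuleCat.{u} Λᵐᵒᵖ, Module.Finite Λᵐᵒᵖ M →
        ∃ g : Fin n → ℤ,
          (∀ g' : Fin n → ℤ, IsGVector P M g' ↔ g' = g) ∧
          (∀ g' : Fin n → ℤ, IsGVector (fun i => (tildeInduction K Λ).obj (P i))
            ((tildeInduction K Λ).obj M) g' ↔ g' = g) := by
  let I := (isDualBasis_tilde K Λ).inductionData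
  have : Module.Finite K Λᵐᵒᵖ := Module.Finite.equiv (MulOpposite.opLinearEquiv K)
  exact ⟨I.bijOn_supportTauTiltingClasses K, I.bijOn_basicSupportTauTiltingClasses K,
    fun n P hP => ⟨I.isProjIndecList hP, fun M hM => I.exists_gVector K hP M hM⟩⟩
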